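/- Let $k\ge 1$, let $X\subset\mathbb{R}^k$ be a nonempty compact set with $X=\overline{\operatorname{int}X}$, and let $N\ge 2$. For $1\le i,j\le N$ let $f_{ij}:X\to X$ satisfy $$c_{ij}\,\|x-y\|\le\|f_{ij}(x)-f_{ij}(y)\|\le s_{ij}\,\|x-y\|\qquad(x,y\in X),$$ where $0<c_{ij}\le s_{ij}<1$. Let $P=[p_{ij}]$ be an irreducible row-stochastic $N\times N$ matrix that is not a permutation matrix. Let $E_1,\dots,E_N$ be the unique nonempty compact subsets of $X$ with $E_i=\bigcup_{j:\,p_{ij}>0}f_{ij}(E_j)$. Let $\Omega$ be the set of sequences $w=(w_1,w_2,\dots)$ in $\{1,\dots,N\}$ with $p_{w_nw_{n+1}}>0$ for all $n$, and let $\pi:\Omega\to X$ map $w$ to the unique point of $\bigcap_{n\ge2}f_{w_1w_2}\circ\cdots\circ f_{w_{n-1}w_n}(E_{w_n})$. Let $p=(p_1,\dots,p_N)$ be the unique probability vector with $pP=p$, let $\nu$ be the unique Borel probability measure on $\Omega$ which gives the cylinder $[w_1,\dots,w_n]$ the mass $p_{w_1}p_{w_1w_2}\cdots p_{w_{n-1}w_n}$,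 and let $\mu=\nu\circ\pi^{-1}$, regarded as a Borel probability measure on $\mathbb{R}^k$. Assume the strong open set condition: there are nonempty sets $U_1,\dots,U_N\subset X$, open in $X$, such that for all $1\le i,j,m,l\le N$: $f_{ij}(U_j)\cap f_{ml}(U_l)=\emptyset$ whenever $(i,j)\ne(m,l)$, $f_{ij}(U_j)\subset U_i$, and $E_i\cap U_i\ne\emptyset$. For $r>0$ and $n\in\mathbb{N}$ put $$V_{n,r}(\mu)=\inf\Big\{\int d(x,A)^r\,d\mu(x):A\subset\mathbb{R}^k,\ \operatorname{card}A\le n\Big\},\qquad e_{n,r}(\mu)=V_{n,r}(\mu)^{1/r},$$ and let $\underline D_r(\mu)$ and $\overline D_r(\mu)$ be the lower and upper limits of $\dfrac{\log n}{-\log e_{n,r}(\mu)}$ as $n\to\infty$. For $t>0$ let $\Phi_r(t)$ and $\phi_r(t)$ be the spectral radii of the matrices $[(p_{ij}s_{ij}^r)^t]_{i,j}$ and $[(p_{ij}c_{ij}^r)^t]_{i,j}$. Then for every $r>0$ there are a unique $k_r\in(0,\infty)$ with $\Phi_r\big(\tfrac{k_r}{r+k_r}\big)=1$ and a unique $l_r\in(0,\infty)$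 with $\phi_r\big(\tfrac{l_r}{r+l_r}\big)=1$, and $$l_r\le\underline D_r(\mu)\le\overline D_r(\mu)\le k_r .$$ -/

import Mathlib

open Set Filter Topology MeasureTheory
open scoped ENNReal NNReal

/-- A bi-Lipschitz recurrent iterated function system `{X; f_ij, p_ij : 1 ≤ i, j ≤ N}` on a
compact set `X ⊆ ℝᵏ`, with its Lipschitz bounds `c_ij ≤ s_ij`. -/
structure BiLipschitzRIFS (k N : ℕ) where
  two_le : 2 ≤ N
  X : Set (EuclideanSpace ℝ (Fin k))
  nonempty : X.Nonempty
  isCompact : IsCompact X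
  closure_interior : closure (interior X) = X
  f : Fin N → Fin N → X → X
  c : Fin N → Fin N → ℝ
  s : Fin N → Fin N → ℝ
  P : Matrix (Fin N) (Fin N) ℝ
  c_pos : ∀ i j, 0 < c i j
  c_le_s : ∀ i j, c i j ≤ s i j
  s_lt_one : ∀ i j, s i j < 1
  lower_bound : ∀ i j x y, c i j * dist x y ≤ dist (f i j x) (f i j y)
  upper_bound : ∀ i j x y, dist (f i j x) (f i j y) ≤ s i j * dist x y
  stochastic : P ∈ Matrix.rowStochastic ℝ (Fin N)
  irreducible : P.IsIrreducible

namespace BiLipschitzRIFS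

variable {k N : ℕ} (I : BiLipschitzRIFS k N)

/-! ### The limit sets -/

/-- `(E_1, …, E_N)` is a tuple of nonempty compact subsets of `X` with
`E_i = ⋃_{j, p_ij > 0} f_ij(E_j)`. -/
def IsInvariantFamily (E : Fin N → Set I.X) : Prop :=
  ∀ i, (E i).Nonempty ∧ IsCompact (E i) ∧ E i = ⋃ j ∈ {j | 0 < I.P i j}, I.f i j '' E j

lemma exists_ratio : ∃ K : ℝ≥0, K < 1 ∧ ∀ i j, LipschitzWith K (I.f i j) := by
  have hN := I.two_le
  have : Nonempty (Fin N × Fin N) := ⟨(⟨0, by omega⟩, ⟨0, by omega⟩)⟩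
  obtain ⟨q, hq⟩ := Finite.exists_max (fun q : Fin N × Fin N => I.s q.1 q.2)
  have h0 : 0 ≤ I.s q.1 q.2 := (I.c_pos _ _).le.trans (I.c_le_s _ _)
  refine ⟨(I.s q.1 q.2).toNNReal, ?_, fun i j => LipschitzWith.of_dist_le_mul fun x y => ?_⟩
  · rw [Real.toNNReal_lt_one]; exact I.s_lt_one _ _
  · rw [Real.coe_toNNReal _ h0]
    exact (I.upper_bound i j x y).trans (mul_le_mul_of_nonneg_right (hq (i, j)) dist_nonneg)

lemma exists_pos (i : Fin N) : ∃ j, 0 < I.P i j := by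
  have : Nontrivial (Fin N) := Fin.nontrivial_iff_two_le.2 I.two_le
  exact I.irreducible.exists_pos i

theorem existsUnique_isInvariantFamily : ∃! E : Fin N → Set I.X, I.IsInvariantFamily E := by
  obtain ⟨K, hK, hf⟩ := I.exists_ratio
  have : CompactSpace I.X := isCompact_iff_compactSpace.1 I.isCompact
  have : Nonempty I.X := I.nonempty.to_subtype
  let T : (Fin N → TopologicalSpace.NonemptyCompacts I.X) →
      (Fin N → TopologicalSpace.NonemptyCompacts I.X) := fun E i =>
    ⟨⟨⋃ j ∈ {j | 0 < I.P i j}, I.f i j '' (E j : Set I.X),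
      (Set.toFinite {j | 0 < I.P i j}).isCompact_biUnion
        fun j _ => (E j).isCompact.image (hf i j).continuous⟩, by
      obtain ⟨j, hj⟩ := I.exists_pos i
      obtain ⟨x, hx⟩ := (E j).nonempty
      exact ⟨I.f i j x, mem_biUnion (x := j) hj ⟨x, hx, rfl⟩⟩⟩
  have hT : ContractingWith K T := by
    refine ⟨hK, fun A B => ?_⟩
    rw [edist_pi_le_iff]
    intro i
    change Metric.hausdorffEDist (⋃ j ∈ {j | 0 < I.P i j}, I.f i j '' (A j : Set I.X))
      (⋃ j ∈ {j | 0 < I.P i j}, I.f i j '' (B j : Set I.X)) ≤ _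
    refine Metric.hausdorffEDist_iUnion_le.trans (iSup_le fun j => ?_)
    refine Metric.hausdorffEDist_iUnion_le.trans (iSup_le fun _ => ?_)
    have h1 : Metric.hausdorffEDist (A j : Set I.X) (B j) ≤ edist A B := edist_le_pi_edist A B j
    have h2 : ∀ A B : TopologicalSpace.NonemptyCompacts I.X, ∀ x ∈ I.f i j '' A,
        Metric.infEDist x (I.f i j '' B) ≤ K * Metric.hausdorffEDist (A : Set I.X) B := by
      rintro A B _ ⟨x, hx, rfl⟩
      obtain ⟨y, hy, hxy⟩ := B.isCompact.exists_infEDist_eq_edist B.nonempty x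
      refine (Metric.infEDist_le_edist_of_mem (mem_image_of_mem _ hy)).trans
        ((hf i j x y).trans ?_)
      rw [← hxy]
      gcongr
      exact Metric.infEDist_le_hausdorffEDist_of_mem hx
    refine (Metric.hausdorffEDist_le_of_infEDist (h2 _ _) fun x hx => ?_).trans
      (mul_le_mul_right h1 _)
    rw [Metric.hausdorffEDist_comm]
    exact h2 _ _ x hx
  have hfix := hT.fixedPoint_isFixedPt
  refine ⟨fun i => (ContractingWith.fixedPoint T hT i : Set I.X), fun i =>
    ⟨TopologicalSpace.NonemptyCompacts.nonempty _,
      TopologicalSpace.NonemptyCompacts.isCompact _, ?_⟩, fun E hE => ?_⟩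
  · exact congrArg (fun E => ((E i : TopologicalSpace.NonemptyCompacts I.X) : Set I.X)) hfix.symm
  · let E' : Fin N → TopologicalSpace.NonemptyCompacts I.X := fun i =>
      ⟨⟨E i, (hE i).2.1⟩, (hE i).1⟩
    have hE' : T E' = E' := by
      funext i
      exact TopologicalSpace.NonemptyCompacts.ext (hE i).2.2.symm
    rw [← hT.fixedPoint_unique hE']
    rfl

/-- The sets `E_1, …, E_N`. -/
noncomputable def limitSet : Fin N → Set I.X := I.existsUnique_isInvariantFamily.choose

lemma isInvariantFamily_limitSet : I.IsInvariantFamily I.limitSet :=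
  I.existsUnique_isInvariantFamily.choose_spec.1

/-! ### The code space and the coding map -/

/-- The infinite admissible words (indexed from `0`), with the topology and the σ-algebra induced
by the product. -/
abbrev CodeSpace : Type := {w : ℕ → Fin N // ∀ n, 0 < I.P (w n) (w (n + 1))}

/-- `wordMap w n = f_{w_0 w_1} ∘ f_{w_1 w_2} ∘ ⋯ ∘ f_{w_{n-1} w_n}`. -/
def wordMap (w : ℕ → Fin N) : ℕ → I.X → I.X
  | 0 => id
  | n + 1 => wordMap w n ∘ I.f (w n) (w (n + 1))

theorem existsUnique_coding (w : I.CodeSpace) :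
    ∃! x : I.X, ∀ n ≥ 1, x ∈ I.wordMap w.1 n '' I.limitSet (w.1 n) := by
  obtain ⟨K, hK, hf⟩ := I.exists_ratio
  have : CompactSpace I.X := isCompact_iff_compactSpace.1 I.isCompact
  have hL : ∀ n, LipschitzWith (K ^ n) (I.wordMap w.1 n) := by
    intro n
    induction n with
    | zero => simpa [wordMap] using LipschitzWith.id
    | succ n ih => rw [pow_succ]; exact ih.comp (hf _ _)
  have hE := I.isInvariantFamily_limitSet
  let S : ℕ → Set I.X := fun n => I.wordMap w.1 n '' I.limitSet (w.1 n)
  have hS : ∀ n, IsCompact (S n) := fun n => (hE _).2.1.image (hL n).continuous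
  have hanti : ∀ n, S (n + 1) ⊆ S n := by
    rintro n _ ⟨x, hx, rfl⟩
    refine ⟨I.f (w.1 n) (w.1 (n + 1)) x, ?_, rfl⟩
    rw [(hE (w.1 n)).2.2]
    exact mem_biUnion (x := w.1 (n + 1)) (w.2 n) ⟨x, hx, rfl⟩
  obtain ⟨x, hx⟩ := IsCompact.nonempty_iInter_of_sequence_nonempty_isCompact_isClosed S hanti
    (fun n => (hE _).1.image _) (hS 0) (fun n => (hS n).isClosed)
  rw [mem_iInter] at hx
  refine ⟨x, fun n _ => hx n, fun y hy => ?_⟩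
  have hlim : Tendsto (fun n : ℕ => (K : ℝ) ^ n * Metric.diam (univ : Set I.X)) atTop (𝓝 0) := by
    simpa using (tendsto_pow_atTop_nhds_zero_of_lt_one K.2 (by exact_mod_cast hK)).mul_const
      (Metric.diam (univ : Set I.X))
  refine dist_le_zero.1 (ge_of_tendsto hlim (eventually_atTop.2 ⟨1, fun n hn => ?_⟩))
  obtain ⟨y', -, rfl⟩ := hy n hn
  obtain ⟨x', -, hx'⟩ := hx n
  rw [← hx']
  refine ((hL n).dist_le_mul _ _).trans ?_
  push_cast
  gcongr
  exact Metric.dist_le_diam_of_mem isCompact_univ.isBounded (mem_univ _) (mem_univ _)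

/-- The coding map `π`: `π(w)` is the point of `⋂_{n ≥ 1} f_{w_0 w_1} ∘ ⋯ ∘ f_{w_{n-1} w_n}(E_{w_n})`. -/
noncomputable def coding (w : I.CodeSpace) : I.X := (I.existsUnique_coding w).choose

lemma continuous_coding : Continuous I.coding := by
  obtain ⟨K, hK, hf⟩ := I.exists_ratio
  have : CompactSpace I.X := isCompact_iff_compactSpace.1 I.isCompact
  have hL : ∀ (w : ℕ → Fin N) n, LipschitzWith (K ^ n) (I.wordMap w n) := by
    intro w n
    induction n with
    | zero => simpa [wordMap] using LipschitzWith.id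
    | succ n ih => rw [pow_succ]; exact ih.comp (hf _ _)
  have hagree : ∀ (w w' : ℕ → Fin N) n, (∀ i ≤ n, w' i = w i) → I.wordMap w' n = I.wordMap w n := by
    intro w w' n
    induction n with
    | zero => intro _; rfl
    | succ n ih =>
      intro h
      rw [wordMap, wordMap, ih fun i hi => h i (by omega), h n (by omega), h (n + 1) le_rfl]
  have hlim : Tendsto (fun n : ℕ => (K : ℝ) ^ n * Metric.diam (univ : Set I.X)) atTop (𝓝 0) := by
    simpa using (tendsto_pow_atTop_nhds_zero_of_lt_one K.2 (by exact_mod_cast hK)).mul_const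
      (Metric.diam (univ : Set I.X))
  rw [continuous_iff_continuousAt]
  intro w
  refine Metric.tendsto_nhds.2 fun ε hε => ?_
  obtain ⟨n, hn, hn1⟩ := ((hlim.eventually_lt_const hε).and (eventually_ge_atTop 1)).exists
  have hnhds : ∀ᶠ w' : I.CodeSpace in 𝓝 w, ∀ i ∈ Finset.range (n + 1), w'.1 i = w.1 i := by
    rw [Filter.eventually_all_finset]
    intro i _
    exact ((continuous_apply i).comp continuous_subtype_val).continuousAt.eventually_mem
      ((isOpen_discrete {w.1 i}).mem_nhds rfl)
  filter_upwards [hnhds] with w' hw'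
  obtain ⟨x, -, hx⟩ := (I.existsUnique_coding w).choose_spec.1 n hn1
  obtain ⟨x', -, hx'⟩ := (I.existsUnique_coding w').choose_spec.1 n hn1
  rw [hagree w.1 w'.1 n fun i hi => hw' i (Finset.mem_range.2 (by omega))] at hx'
  change dist (I.existsUnique_coding w').choose (I.existsUnique_coding w).choose < ε
  rw [← hx, ← hx']
  refine lt_of_le_of_lt (((hL w.1 n).dist_le_mul _ _).trans ?_) hn
  push_cast
  gcongr
  exact Metric.dist_le_diam_of_mem isCompact_univ.isBounded (mem_univ _) (mem_univ _)

lemma measurable_coding : Measurable fun w : I.CodeSpace =>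
    (I.coding w : EuclideanSpace ℝ (Fin k)) :=
  (continuous_subtype_val.comp I.continuous_coding).measurable

/-! ### The Markov measure -/

/-- `p` is a probability vector with `pP = p`. -/
def IsStationary (p : Fin N → ℝ) : Prop :=
  (∀ i, 0 ≤ p i) ∧ ∑ i, p i = 1 ∧ Matrix.vecMul p I.P = p

lemma eq_zero_of_vecMul_eq {u : Fin N → ℝ} (h0 : ∀ i, 0 ≤ u i) (hu : Matrix.vecMul u I.P = u)
    {i : Fin N} (hi : u i = 0) : u = 0 := by
  have hN := I.two_le
  have hk : ∀ n : ℕ, Matrix.vecMul u (I.P ^ n) = u := by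
    intro n
    induction n with
    | zero => simp
    | succ n ih => rw [pow_succ, ← Matrix.vecMul_vecMul, ih, hu]
  funext j
  obtain ⟨n, -, hn⟩ :=
    (Matrix.isIrreducible_iff_exists_pow_pos I.irreducible.nonneg).1 I.irreducible j i
  have h1 : ∑ l, u l * (I.P ^ n) l i = 0 := by
    have := congrFun (hk n) i
    rwa [hi] at this
  have h2 := (Finset.sum_eq_zero_iff_of_nonneg fun l _ => mul_nonneg (h0 l)
    (Matrix.pow_apply_nonneg I.irreducible.nonneg n l i)).1 h1 j (Finset.mem_univ j)
  exact (mul_eq_zero.1 h2).resolve_right hn.ne'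

lemma abs_vecMul_eq {v : Fin N → ℝ} (hv : Matrix.vecMul v I.P = v) :
    Matrix.vecMul (fun i => |v i|) I.P = fun i => |v i| := by
  have hle : ∀ j ∈ Finset.univ, |v j| ≤ ∑ i, |v i| * I.P i j := by
    intro j _
    calc |v j| = |∑ i, v i * I.P i j| := congrArg abs (congrFun hv j).symm
      _ ≤ ∑ i, |v i * I.P i j| := Finset.abs_sum_le_sum_abs _ _
      _ = ∑ i, |v i| * I.P i j := by
        simp_rw [abs_mul, abs_of_nonneg (I.stochastic.1 _ j)]
  have hsum : ∑ j, |v j| = ∑ j, ∑ i, |v i| * I.P i j := by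
    rw [Finset.sum_comm]
    simp_rw [← Finset.mul_sum, Matrix.sum_row_of_mem_rowStochastic I.stochastic, mul_one]
  funext j
  exact ((Finset.sum_eq_sum_iff_of_le hle).1 hsum j (Finset.mem_univ j)).symm

lemma IsStationary.unique {p q : Fin N → ℝ} (hp : I.IsStationary p) (hq : I.IsStationary q) :
    p = q := by
  have hN := I.two_le
  have hd : Matrix.vecMul (p - q) I.P = p - q := by
    rw [Matrix.sub_vecMul, hp.2.2, hq.2.2]
  have hsum : ∑ i, (p - q) i = 0 := by
    simp only [Pi.sub_apply, Finset.sum_sub_distrib, hp.2.1, hq.2.1, sub_self]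
  obtain ⟨i, hi⟩ : ∃ i, (p - q) i ≤ 0 := by
    by_contra! h
    exact (Finset.sum_pos (fun i _ => h i) ⟨⟨0, by omega⟩, Finset.mem_univ _⟩).ne' hsum
  have hu : (fun i => |(p - q) i|) + (p - q) = 0 := by
    refine I.eq_zero_of_vecMul_eq (i := i) (fun j => ?_) ?_ ?_
    · have := neg_abs_le ((p - q) j)
      simp only [Pi.add_apply]
      linarith
    · rw [Matrix.add_vecMul, I.abs_vecMul_eq hd, hd]
    · simp only [Pi.add_apply, abs_of_nonpos hi, neg_add_cancel]
  have hneg : ∀ j ∈ Finset.univ, (p - q) j ≤ 0 := by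
    intro j _
    have h1 := congrFun hu j
    have h2 := abs_nonneg ((p - q) j)
    simp only [Pi.add_apply, Pi.zero_apply] at h1
    linarith
  funext j
  exact sub_eq_zero.1 ((Finset.sum_eq_zero_iff_of_nonpos hneg).1 hsum j (Finset.mem_univ j))

theorem existsUnique_isStationary : ∃! p : Fin N → ℝ, I.IsStationary p := by
  have hN := I.two_le
  have : Nonempty (Fin N) := ⟨⟨0, by omega⟩⟩
  have hdet : (I.P - 1).det = 0 := by
    refine Matrix.exists_mulVec_eq_zero_iff.1 ⟨1, one_ne_zero, ?_⟩
    rw [Matrix.sub_mulVec, I.stochastic.2, Matrix.one_mulVec, sub_self]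
  obtain ⟨v, hv0, hv⟩ := Matrix.exists_vecMul_eq_zero_iff.2 hdet
  rw [Matrix.vecMul_sub, Matrix.vecMul_one, sub_eq_zero] at hv
  have hpos : 0 < ∑ i, |v i| := by
    obtain ⟨i, hi⟩ := Function.ne_iff.1 hv0
    exact Finset.sum_pos' (fun _ _ => abs_nonneg _) ⟨i, Finset.mem_univ i, abs_pos.2 hi⟩
  suffices h : I.IsStationary ((∑ i, |v i|)⁻¹ • fun i => |v i|) from
    ⟨_, h, fun p hp => IsStationary.unique I hp h⟩
  refine ⟨fun i => ?_, ?_, ?_⟩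
  · exact mul_nonneg (inv_nonneg.2 hpos.le) (abs_nonneg _)
  · simp only [Pi.smul_apply, smul_eq_mul, ← Finset.mul_sum]
    exact inv_mul_cancel₀ hpos.ne'
  · rw [Matrix.smul_vecMul, I.abs_vecMul_eq hv]

/-- The stationary probability vector `p = (p_1, …, p_N)` of the matrix `P`. -/
noncomputable def stationary : Fin N → ℝ := I.existsUnique_isStationary.choose

/-- `ν` is a probability measure with
`ν([w_0, …, w_n]) = p_{w_0} p_{w_0 w_1} ⋯ p_{w_{n-1} w_n}` for all words. -/
def IsMarkovMeasure (ν : Measure I.CodeSpace) : Prop :=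
  IsProbabilityMeasure ν ∧ ∀ (w : ℕ → Fin N) (n : ℕ),
    ν {τ | ∀ i ≤ n, τ.1 i = w i} =
      ENNReal.ofReal (I.stationary (w 0) * ∏ i ∈ Finset.range n, I.P (w i) (w (i + 1)))

lemma isStationary_stationary : I.IsStationary I.stationary :=
  I.existsUnique_isStationary.choose_spec.1

lemma IsMarkovMeasure.unique {ν ν' : Measure I.CodeSpace} (h : I.IsMarkovMeasure ν)
    (h' : I.IsMarkovMeasure ν') : ν = ν' := by
  have := h.1
  have := h'.1
  let C : Set (Set I.CodeSpace) :=
    {s | ∃ (w : ℕ → Fin N) (n : ℕ), s = {τ : I.CodeSpace | ∀ i ≤ n, τ.1 i = w i}}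
  refine ext_of_generate_finite C ?_ ?_ ?_ (by simp)
  · refine le_antisymm ?_ ?_
    · refine Measurable.comap_le (m₁ := MeasurableSpace.generateFrom C) ?_
      refine (@measurable_pi_iff _ _ _ (MeasurableSpace.generateFrom C) _ _).2 fun n => ?_
      refine @measurable_to_countable' _ _ _ _ (MeasurableSpace.generateFrom C) _ fun a => ?_
      have : (fun τ : I.CodeSpace => τ.1 n) ⁻¹' {a} =
          ⋃ v ∈ {v : Fin (n + 1) → Fin N | v ⟨n, by omega⟩ = a},
            {τ : I.CodeSpace | ∀ i ≤ n, τ.1 i = v ⟨min i n, by omega⟩} := by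
        ext τ
        simp only [mem_preimage, mem_singleton_iff, mem_iUnion, mem_ofPred_eq, exists_prop]
        constructor
        · intro h
          exact ⟨fun i => τ.1 i, h, fun i hi => by simp [min_eq_left hi]⟩
        · rintro ⟨v, hv, h⟩
          rw [h n le_rfl]
          simpa using hv
      rw [this]
      exact @MeasurableSet.biUnion _ _ (MeasurableSpace.generateFrom C) _ _ (Set.to_countable _)
        fun v _ => MeasurableSpace.measurableSet_generateFrom
          ⟨fun i => v ⟨min i n, by omega⟩, n, rfl⟩
    · refine MeasurableSpace.generateFrom_le ?_
      rintro _ ⟨w, n, rfl⟩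
      have : {τ : I.CodeSpace | ∀ i ≤ n, τ.1 i = w i} =
          ⋂ i ∈ Set.Iic n, (fun τ : I.CodeSpace => τ.1 i) ⁻¹' {w i} := by
        ext; simp
      rw [this]
      exact MeasurableSet.biInter (Set.to_countable _) fun i _ =>
        ((measurable_pi_apply i).comp measurable_subtype_coe) (measurableSet_singleton _)
  · rintro _ ⟨w, n, rfl⟩ _ ⟨w', n', rfl⟩ ⟨τ, hτ, hτ'⟩
    refine ⟨τ.1, max n n', ?_⟩
    ext σ
    constructor
    · rintro ⟨h1, h2⟩ i hi
      rcases le_max_iff.1 hi with hi | hi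
      · rw [h1 i hi, hτ i hi]
      · rw [h2 i hi, hτ' i hi]
    · intro h1
      exact ⟨fun i hi => (h1 i (le_max_of_le_left hi)).trans (hτ i hi),
        fun i hi => (h1 i (le_max_of_le_right hi)).trans (hτ' i hi)⟩
  · rintro _ ⟨w, n, rfl⟩
    rw [h.2, h'.2]

lemma exists_measure_singleton {q : Fin N → ℝ} (h0 : ∀ i, 0 ≤ q i) (h1 : ∑ i, q i = 1) :
    ∃ ρ : Measure (Fin N), IsProbabilityMeasure ρ ∧ ∀ i, ρ {i} = ENNReal.ofReal (q i) := by
  refine ⟨∑ i, ENNReal.ofReal (q i) • Measure.dirac i, ⟨?_⟩, fun i => ?_⟩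
  · simp [← ENNReal.ofReal_sum_of_nonneg fun i _ => h0 i, h1]
  · simp [Set.indicator_apply]

/-- A stationary Markov chain driven by independent random self-maps of the state space. -/
def chain (i₀ : Fin N) (ω : ℕ → Fin N → Fin N) : ℕ → Fin N
  | 0 => ω 0 i₀
  | n + 1 => ω (n + 1) (chain i₀ ω n)

theorem exists_markov_sequence : ∃ m : Measure (ℕ → Fin N), IsProbabilityMeasure m ∧
    ∀ (w : ℕ → Fin N) (n : ℕ), m {τ | ∀ i ≤ n, τ i = w i} =
      ENNReal.ofReal (I.stationary (w 0) * ∏ i ∈ Finset.range n, I.P (w i) (w (i + 1))) := by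
  have hN := I.two_le
  have hp := I.isStationary_stationary
  obtain ⟨ρ₀, hρ₀, hρ₀'⟩ := exists_measure_singleton hp.1 hp.2.1
  choose ρ hρ hρ' using fun i => exists_measure_singleton (I.stochastic.1 i)
    (Matrix.sum_row_of_mem_rowStochastic I.stochastic i)
  let i₀ : Fin N := ⟨0, by omega⟩
  obtain ⟨M, hM0, hMs⟩ : ∃ M : ℕ → Measure (Fin N → Fin N),
      M 0 = Measure.pi (fun _ => ρ₀) ∧ ∀ n, M (n + 1) = Measure.pi ρ :=
    ⟨fun n => Nat.casesOn n (Measure.pi fun _ => ρ₀) fun _ => Measure.pi ρ, rfl, fun _ => rfl⟩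
  have hM : ∀ n, IsProbabilityMeasure (M n) := by
    rintro (_ | n)
    · rw [hM0]; infer_instance
    · rw [hMs]; infer_instance
  have hmeas : Measurable (chain i₀ : (ℕ → Fin N → Fin N) → ℕ → Fin N) := by
    refine measurable_pi_iff.2 fun n => ?_
    induction n with
    | zero =>
      exact (measurable_pi_apply i₀).comp (measurable_pi_apply 0)
    | succ n ih =>
      refine measurable_to_countable' fun a => ?_
      have : (fun ω : ℕ → Fin N → Fin N => chain i₀ ω (n + 1)) ⁻¹' {a} =
          ⋃ b, (fun ω => chain i₀ ω n) ⁻¹' {b} ∩ (fun ω => ω (n + 1) b) ⁻¹' {a} := by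
        ext ω
        simp [chain]
      rw [this]
      exact MeasurableSet.iUnion fun b => (ih (measurableSet_singleton b)).inter
        (((measurable_pi_apply b).comp (measurable_pi_apply (n + 1))) (measurableSet_singleton a))
  have hQ : IsProbabilityMeasure (Measure.infinitePi (X := fun _ => Fin N → Fin N) M) :=
    inferInstance
  refine ⟨(Measure.infinitePi (X := fun _ => Fin N → Fin N) M).map (chain i₀), Measure.isProbabilityMeasure_map hmeas.aemeasurable, fun w n => ?_⟩
  have hcyl : MeasurableSet {τ : ℕ → Fin N | ∀ i ≤ n, τ i = w i} := by
    have : {τ : ℕ → Fin N | ∀ i ≤ n, τ i = w i} =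
        ⋂ i ∈ Set.Iic n, (fun τ : ℕ → Fin N => τ i) ⁻¹' {w i} := by
      ext; simp
    rw [this]
    exact MeasurableSet.biInter (Set.to_countable _) fun i _ =>
      measurable_pi_apply i (measurableSet_singleton _)
  rw [Measure.map_apply hmeas hcyl]
  let t : ℕ → Set (Fin N → Fin N) := fun
    | 0 => {φ | φ i₀ = w 0}
    | i + 1 => {φ | φ (w i) = w (i + 1)}
  have ht : chain i₀ ⁻¹' {τ : ℕ → Fin N | ∀ i ≤ n, τ i = w i} =
      Set.pi (Finset.range (n + 1) : Finset ℕ) t := by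
    ext ω
    simp only [mem_preimage, mem_ofPred_eq, Set.mem_pi, Finset.coe_range, mem_Iio,
      Nat.lt_succ_iff]
    constructor
    · rintro h (_ | i) hi
      · exact h 0 hi
      · have h1 := h (i + 1) hi
        rw [chain, h i (by omega)] at h1
        exact h1
    · intro h i
      induction i with
      | zero => exact fun hi => h 0 hi
      | succ i ih =>
        intro hi
        rw [chain, ih (by omega)]
        exact h (i + 1) hi
  have heval : ∀ (q : Fin N → Measure (Fin N)) [∀ i, IsProbabilityMeasure (q i)] (a b : Fin N),
      Measure.pi q {φ | φ a = b} = q a {b} := by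
    intro q _ a b
    exact (measurePreserving_eval q a).measure_preimage
      (measurableSet_singleton b).nullMeasurableSet
  have htm : ∀ i, MeasurableSet (t i) :=
    fun i => (Set.toFinite (t i)).measurableSet
  have hprod : Measure.infinitePi (X := fun _ => Fin N → Fin N) M
      (Set.pi (Finset.range (n + 1) : Finset ℕ) t) = ∏ i ∈ Finset.range (n + 1), M i (t i) :=
    Measure.infinitePi_pi (X := fun _ => Fin N → Fin N) (μ := M) (t := t)
      fun i _ => htm i
  rw [ht, hprod, Finset.prod_range_succ']
  have h1 : ∀ i, M (i + 1) (t (i + 1)) = ENNReal.ofReal (I.P (w i) (w (i + 1))) := fun i => by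
    rw [hMs]; exact (heval ρ _ _).trans (hρ' _ _)
  have h2 : M 0 (t 0) = ENNReal.ofReal (I.stationary (w 0)) := by
    rw [hM0]; exact (heval (fun _ => ρ₀) _ _).trans (hρ₀' _)
  simp_rw [h1, h2]
  rw [ENNReal.ofReal_mul (hp.1 _), ENNReal.ofReal_prod_of_nonneg fun i _ => I.stochastic.1 _ _,
    mul_comm]

theorem existsUnique_isMarkovMeasure : ∃! ν : Measure I.CodeSpace, I.IsMarkovMeasure ν := by
  obtain ⟨m, hm, hcyl⟩ := I.exists_markov_sequence
  have hmeas : MeasurableSet {w : ℕ → Fin N | ∀ n, 0 < I.P (w n) (w (n + 1))} := by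
    rw [ofPred_forall]
    refine MeasurableSet.iInter fun n => ?_
    have h1 : Measurable fun w : ℕ → Fin N => (w n, w (n + 1)) :=
      (measurable_pi_apply n).prodMk (measurable_pi_apply (n + 1))
    exact h1 (Set.toFinite {q : Fin N × Fin N | 0 < I.P q.1 q.2}).measurableSet
  have hae : ∀ᵐ w ∂m, ∀ n, 0 < I.P (w n) (w (n + 1)) := by
    rw [ae_all_iff]
    intro n
    have hsub : {w : ℕ → Fin N | ¬ 0 < I.P (w n) (w (n + 1))} ⊆
        ⋃ v ∈ {v : Fin (n + 2) → Fin N | ¬ 0 < I.P (v ⟨n, by omega⟩) (v ⟨n + 1, by omega⟩)},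
          {τ | ∀ i ≤ n + 1, τ i = v ⟨min i (n + 1), by omega⟩} := by
      intro w hw
      refine mem_biUnion (x := fun i : Fin (n + 2) => w i) hw fun i hi => ?_
      simp [min_eq_left hi]
    refine measure_mono_null hsub ((measure_biUnion_null_iff (Set.to_countable _)).2 fun v hv => ?_)
    rw [hcyl (fun i => v ⟨min i (n + 1), by omega⟩), Finset.prod_range_succ]
    have h0 : I.P (v ⟨n, by omega⟩) (v ⟨n + 1, by omega⟩) = 0 :=
      le_antisymm (not_lt.1 hv) (I.stochastic.1 _ _)
    simp [h0]
  have hemb : MeasurableEmbedding (Subtype.val : I.CodeSpace → ℕ → Fin N) :=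
    MeasurableEmbedding.subtype_coe hmeas
  suffices h : I.IsMarkovMeasure (m.comap Subtype.val) from
    ⟨_, h, fun ν hν => IsMarkovMeasure.unique I hν h⟩
  have hinter : ∀ s : Set (ℕ → Fin N),
      m.comap (Subtype.val : I.CodeSpace → ℕ → Fin N) (Subtype.val ⁻¹' s) = m s := by
    intro s
    rw [hemb.comap_apply]
    refine measure_congr ?_
    filter_upwards [hae] with w hw
    exact propext ⟨fun ⟨τ, hτ, h⟩ => h ▸ hτ, fun h => ⟨⟨w, hw⟩, h, rfl⟩⟩
  exact ⟨⟨by simpa using hinter univ⟩, fun w n => (hinter _).trans (hcyl w n)⟩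

/-- The Markov measure `ν` on the code space. -/
noncomputable def markovMeasure : Measure I.CodeSpace := I.existsUnique_isMarkovMeasure.choose

/-- The measure `μ = ν ∘ π⁻¹`, as a Borel measure on `ℝᵏ`. -/
noncomputable def limitMeasure : Measure (EuclideanSpace ℝ (Fin k)) :=
  I.markovMeasure.map fun w => (I.coding w : EuclideanSpace ℝ (Fin k))

/-! ### The strong open set condition and the spectral radii -/

/-- The strong open set condition; the sets `U_i` are open in the space `X`. -/
def StrongOpenSetCondition : Prop :=
  ∃ U : Fin N → Set I.X,
    (∀ i, IsOpen (U i) ∧ (U i).Nonempty) ∧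
    (∀ i j m l, (i, j) ≠ (m, l) → Disjoint (I.f i j '' U j) (I.f m l '' U l)) ∧
    (∀ i j, I.f i j '' U j ⊆ U i) ∧
    ∀ i, (I.limitSet i ∩ U i).Nonempty

/-- `Φ_r(t)`, the spectral radius of `[(p_ij s_ij^r)^t]`. -/
noncomputable def upperRadius (r t : ℝ) : ℝ≥0∞ :=
  spectralRadius ℂ (Matrix.of fun i j => (((I.P i j * I.s i j ^ r) ^ t : ℝ) : ℂ))

/-- `φ_r(t)`, the spectral radius of `[(p_ij c_ij^r)^t]`. -/
noncomputable def lowerRadius (r t : ℝ) : ℝ≥0∞ :=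
  spectralRadius ℂ (Matrix.of fun i j => (((I.P i j * I.c i j ^ r) ^ t : ℝ) : ℂ))

end BiLipschitzRIFS

/-! ### Quantization dimensions -/

/-- The `n`-th quantization error `V_{n,r}(μ)` of order `r`. -/
noncomputable def quantizationError {k : ℕ} (μ : Measure (EuclideanSpace ℝ (Fin k)))
    (r : ℝ) (n : ℕ) : ℝ≥0∞ :=
  ⨅ (A : Finset (EuclideanSpace ℝ (Fin k))) (_ : A.card ≤ n),
    ∫⁻ x, Metric.infEDist x (A : Set (EuclideanSpace ℝ (Fin k))) ^ r ∂μ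

/-- `log n / (- log e_{n,r}(μ))` with `e_{n,r}(μ) = V_{n,r}(μ)^{1/r}`. -/
noncomputable def quantizationRatio {k : ℕ} (μ : Measure (EuclideanSpace ℝ (Fin k)))
    (r : ℝ) (n : ℕ) : ℝ :=
  Real.log n / -Real.log ((quantizationError μ r n).toReal ^ (1 / r))

/-- The lower quantization dimension of order `r`. -/
noncomputable def lowerQuantizationDim {k : ℕ} (μ : Measure (EuclideanSpace ℝ (Fin k)))
    (r : ℝ) : EReal :=
  liminf (fun n : ℕ => (quantizationRatio μ r n : EReal)) atTop

/-- The upper quantization dimension of order `r`. -/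
noncomputable def upperQuantizationDim {k : ℕ} (μ : Measure (EuclideanSpace ℝ (Fin k)))
    (r : ℝ) : EReal :=
  limsup (fun n : ℕ => (quantizationRatio μ r n : EReal)) atTop

/-! Write M_a(t) for `pressureMatrix a r t`, the matrix of the (p_ij a_ij^r)^t. Raising t by δ
multiplies every nonzero entry by a factor between q^δ and b^δ with 0 < q, b < 1. Hence the spectral
radius varies continuously and decreases strictly wherever it is positive. At t = 1 it is below 1.
As t tends to 0 it eventually exceeds 1, because the adjacency matrix of an irreducible stochastic
matrix that is not a permutation matrix has radius greater than 1. So each radius takes the value 1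
exactly once on (0,1), and u ↦ u/(r+u) carries (0,∞) onto (0,1).

Upper bound. If M_s(t) has radius below 1, there is a positive vector v with M_s(t) v ≤ v
(`exists_mulVec_le_self`). Cutting words when p_w s_w^r falls to about ε, this vector bounds the
number of words by a multiple of ε^(-t) and their total weight by a multiple of ε^(1-t)
(`exists_covering_words`). One point in each piece then gives V_n ≤ C n^(-(1-t)/t). No separation is
needed.

Lower bound. If M_c(t) has radius above 1, some row sum over words of a fixed length is as large as
desired. The strong open set condition allows each such word to be prolonged to a loop at a fixed
letter i so that the images of X become disjoint, hence a positive distance apart, while the sum of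
the t-th powers of the weights stays at least 1 (`exists_separated_loops`). Concatenating loops
yields at least ε^(-t) words of weight at least qε whose pieces have disjoint neighbourhoods of
radius proportional to c_w (`exists_separated_words`). With 2n such pieces, n centres miss at least
n neighbourhoods, and each missed piece costs a multiple of ε, so V_n ≥ C n^(-(1-t)/t).

For t = v/(r+v) the exponent (1-t)/t is r/v. Letting v tend to k_r from above, and to l_r from
below, gives the theorem. -/

/-! ### Spectral radii of nonnegative matrices -/

section PerronRadius

attribute [local instance] Matrix.linftyOpNormedRing Matrix.linftyOpNormedAlgebra

variable {n : Type*} [Fintype n] [DecidableEq n]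

/-- The spectral radius of a real matrix, as a real number. -/
noncomputable def realRadius (A : Matrix n n ℝ) : ℝ :=
  (spectralRadius ℂ (A.map ((↑) : ℝ → ℂ))).toReal

lemma linfty_opNorm_map_ofReal_pow (A : Matrix n n ℝ) (m : ℕ) :
    ‖A.map ((↑) : ℝ → ℂ) ^ m‖ = ‖A ^ m‖ := by
  have h : A.map ((↑) : ℝ → ℂ) ^ m = (A ^ m).map ((↑) : ℝ → ℂ) :=
    (map_pow (Complex.ofRealHom.mapMatrix) A m).symm
  rw [h, Matrix.linfty_opNorm_def, Matrix.linfty_opNorm_def]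
  simp [Matrix.map_apply]

lemma spectralRadius_map_ofReal_eq_one_iff (A : Matrix n n ℝ) :
    spectralRadius ℂ (A.map ((↑) : ℝ → ℂ)) = 1 ↔ realRadius A = 1 := by
  rw [realRadius, ENNReal.toReal_eq_one_iff]

lemma realRadius_nonneg (A : Matrix n n ℝ) : 0 ≤ realRadius A := ENNReal.toReal_nonneg

lemma linfty_opNorm_le_iff {A : Matrix n n ℝ} {C : ℝ} (hC : 0 ≤ C) (hA : ∀ i j, 0 ≤ A i j) :
    ‖A‖ ≤ C ↔ ∀ i, ∑ j, A i j ≤ C := by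
  lift C to ℝ≥0 using hC
  rw [Matrix.linfty_opNorm_def, NNReal.coe_le_coe, Finset.sup_le_iff]
  refine forall_congr' fun i => ?_
  simp only [Finset.mem_univ, true_imp_iff]
  rw [← NNReal.coe_le_coe]
  push_cast
  simp only [Real.norm_of_nonneg (hA i _)]

lemma row_sum_le_linfty_opNorm {A : Matrix n n ℝ} (hA : ∀ i j, 0 ≤ A i j) (i : n) :
    ∑ j, A i j ≤ ‖A‖ :=
  (linfty_opNorm_le_iff (norm_nonneg A) hA).1 le_rfl i

lemma pow_entry_le {A B : Matrix n n ℝ} {c : ℝ} (hc : 0 ≤ c) (hA : ∀ i j, 0 ≤ A i j)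
    (hB : ∀ i j, 0 ≤ B i j) (h : ∀ i j, A i j ≤ c * B i j) (m : ℕ) (i j : n) :
    (A ^ m) i j ≤ c ^ m * (B ^ m) i j := by
  induction m generalizing i j with
  | zero => simp
  | succ m ih =>
    rw [pow_succ, pow_succ, Matrix.mul_apply, pow_succ, Matrix.mul_apply, Finset.mul_sum]
    refine Finset.sum_le_sum fun l _ => ?_
    calc (A ^ m) i l * A l j ≤ (c ^ m * (B ^ m) i l) * (c * B l j) :=
          mul_le_mul (ih i l) (h l j) (hA l j)
            (mul_nonneg (pow_nonneg hc m) (Matrix.pow_apply_nonneg hB m i l))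
      _ = c ^ m * c * ((B ^ m) i l * B l j) := by ring

variable [Nonempty n]

lemma spectralRadius_map_ofReal_ne_top (A : Matrix n n ℝ) :
    spectralRadius ℂ (A.map ((↑) : ℝ → ℂ)) ≠ ⊤ := by
  have : CompleteSpace (Matrix n n ℂ) := FiniteDimensional.complete ℂ _
  have : NormOneClass (Matrix n n ℂ) := by
    constructor
    rw [← Matrix.diagonal_one, Matrix.linfty_opNorm_diagonal]
    simp
  exact ne_top_of_le_ne_top ENNReal.coe_ne_top
    (spectrum.spectralRadius_le_nnnorm (𝕜 := ℂ) (A.map ((↑) : ℝ → ℂ)))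

/-- Gelfand's formula for the complexification, whose powers have the same maximal row sum norm as
the real powers. -/
lemma tendsto_norm_pow_realRadius (A : Matrix n n ℝ) :
    Tendsto (fun m : ℕ => ‖A ^ m‖ ^ (1 / m : ℝ)) atTop (𝓝 (realRadius A)) := by
  have : CompleteSpace (Matrix n n ℂ) := FiniteDimensional.complete ℂ _
  have h := spectrum.pow_norm_pow_one_div_tendsto_nhds_spectralRadius (A.map ((↑) : ℝ → ℂ))
  have h' := (ENNReal.tendsto_toReal (spectralRadius_map_ofReal_ne_top A)).comp h
  refine h'.congr fun m => ?_
  simp only [Function.comp]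
  rw [ENNReal.toReal_ofReal (by positivity), linfty_opNorm_map_ofReal_pow]

lemma realRadius_pow_le_norm_pow (A : Matrix n n ℝ) (m : ℕ) :
    realRadius A ^ (m + 1) ≤ ‖A ^ (m + 1)‖ := by
  have : CompleteSpace (Matrix n n ℂ) := FiniteDimensional.complete ℂ _
  have : NormOneClass (Matrix n n ℂ) := by
    constructor
    rw [← Matrix.diagonal_one, Matrix.linfty_opNorm_diagonal]
    simp
  rw [realRadius, ← ENNReal.toReal_pow, ← linfty_opNorm_map_ofReal_pow]
  refine ENNReal.toReal_le_of_le_ofReal (norm_nonneg _) ?_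
  refine (spectrum.spectralRadius_pow_le (𝕜 := ℂ) _ _ m.succ_ne_zero).trans
    ((spectrum.spectralRadius_le_nnnorm (𝕜 := ℂ) _).trans_eq ?_)
  rw [ofReal_norm]
  rfl

/-- Entrywise domination passes to powers, then to row sums, and Gelfand's formula turns it into a
comparison of radii. All dependence on t is controlled this way, without eigenvectors. -/
lemma realRadius_le_mul {A B : Matrix n n ℝ} {c : ℝ} (hc : 0 ≤ c) (hA : ∀ i j, 0 ≤ A i j)
    (hB : ∀ i j, 0 ≤ B i j) (h : ∀ i j, A i j ≤ c * B i j) :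
    realRadius A ≤ c * realRadius B := by
  refine le_of_tendsto_of_tendsto (tendsto_norm_pow_realRadius A)
    ((tendsto_norm_pow_realRadius B).const_mul c) ?_
  filter_upwards [eventually_ge_atTop 1] with m hm
  have hm0 : (m : ℝ) ≠ 0 := by positivity
  have h1 : ‖A ^ m‖ ≤ c ^ m * ‖B ^ m‖ := by
    rw [linfty_opNorm_le_iff (by positivity) (Matrix.pow_apply_nonneg hA m)]
    intro i
    calc ∑ j, (A ^ m) i j ≤ ∑ j, c ^ m * (B ^ m) i j :=
          Finset.sum_le_sum fun j _ => pow_entry_le hc hA hB h m i j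
      _ = c ^ m * ∑ j, (B ^ m) i j := by rw [Finset.mul_sum]
      _ ≤ c ^ m * ‖B ^ m‖ := by
        gcongr
        exact row_sum_le_linfty_opNorm (Matrix.pow_apply_nonneg hB m) i
  calc ‖A ^ m‖ ^ (1 / m : ℝ) ≤ (c ^ m * ‖B ^ m‖) ^ (1 / m : ℝ) := by gcongr
    _ = c * ‖B ^ m‖ ^ (1 / m : ℝ) := by
      rw [Real.mul_rpow (by positivity) (norm_nonneg _), ← Real.rpow_natCast, ← Real.rpow_mul hc,
        mul_one_div_cancel hm0, Real.rpow_one]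

lemma realRadius_le_of_row_sum_le {A : Matrix n n ℝ} {C : ℝ} (hC : 0 ≤ C)
    (hA : ∀ i j, 0 ≤ A i j) (h : ∀ i, ∑ j, A i j ≤ C) : realRadius A ≤ C := by
  have h1 := realRadius_pow_le_norm_pow A 0
  simp only [zero_add, pow_one] at h1
  exact h1.trans ((linfty_opNorm_le_iff hC hA).2 h)

/-- Row sums are supermultiplicative in this sense: those of A^(ml) are at least b^l. Gelfand's
formula along the multiples of m then gives radius at least b^(1/m). -/
lemma one_lt_realRadius {A : Matrix n n ℝ} (hA : ∀ i j, 0 ≤ A i j) {m : ℕ} {b : ℝ} (hb : 1 < b)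
    (h : ∀ i, b ≤ ∑ j, (A ^ m) i j) : 1 < realRadius A := by
  have hm : m ≠ 0 := by
    rintro rfl
    have := h (Classical.arbitrary n)
    simp [Matrix.one_apply] at this
    linarith
  have hm0 : (0 : ℝ) < m := by positivity
  have hAm := Matrix.pow_apply_nonneg hA m
  have h1 : ∀ l : ℕ, ∀ i, b ^ l ≤ ∑ j, (A ^ (m * l)) i j := by
    intro l
    induction l with
    | zero => intro i; simp [Matrix.one_apply]
    | succ l ih =>
      intro i
      have h2 : ∀ j, (A ^ (m * (l + 1))) i j = ∑ k, (A ^ m) i k * (A ^ (m * l)) k j := fun j => by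
        rw [Nat.mul_succ, Nat.add_comm, pow_add, Matrix.mul_apply]
      rw [Finset.sum_congr rfl fun j _ => h2 j, Finset.sum_comm]
      calc b ^ (l + 1) = b * b ^ l := by ring
        _ ≤ (∑ k, (A ^ m) i k) * b ^ l := by gcongr; exact h i
        _ = ∑ k, (A ^ m) i k * b ^ l := by rw [Finset.sum_mul]
        _ ≤ ∑ k, ∑ j, (A ^ m) i k * (A ^ (m * l)) k j := by
          refine Finset.sum_le_sum fun k _ => ?_
          rw [← Finset.mul_sum]
          exact mul_le_mul_of_nonneg_left (ih k) (hAm i k)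
  have hb1 : 1 < b ^ (1 / m : ℝ) := Real.one_lt_rpow hb (by positivity)
  refine hb1.trans_le ?_
  have hsub : Tendsto (fun l : ℕ => m * l) atTop atTop :=
    tendsto_id.const_mul_atTop' (Nat.pos_of_ne_zero hm)
  refine ge_of_tendsto ((tendsto_norm_pow_realRadius A).comp hsub) ?_
  filter_upwards [eventually_ge_atTop 1] with l hl
  have hl0 : (0 : ℝ) < l := by positivity
  calc b ^ (1 / m : ℝ) = (b ^ l) ^ (1 / ((m * l : ℕ) : ℝ)) := by
        rw [← Real.rpow_natCast, ← Real.rpow_mul (by positivity)]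
        congr 1
        push_cast
        field_simp
    _ ≤ _ := by
        simp only [Function.comp]
        gcongr
        exact (h1 l (Classical.arbitrary n)).trans
          (row_sum_le_linfty_opNorm (Matrix.pow_apply_nonneg hA _) _)

/-- A nonnegative matrix of spectral radius less than one has a positive subinvariant vector. -/
lemma exists_mulVec_le_self {A : Matrix n n ℝ} (hA : ∀ i j, 0 ≤ A i j) (h : realRadius A < 1) :
    ∃ v : n → ℝ, (∀ i, 1 ≤ v i) ∧ ∀ i, ∑ j, A i j * v j ≤ v i := by
  obtain ⟨m, hm, hm1⟩ := (((tendsto_norm_pow_realRadius A).eventually_lt_const h).and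
    (eventually_ge_atTop 1)).exists
  have hm2 : ‖A ^ m‖ ≤ 1 := by
    by_contra! hlt
    exact hm.not_ge (Real.one_le_rpow hlt.le (by positivity))
  have hr : ∀ i, ∑ j, (A ^ m) i j ≤ 1 := fun i =>
    (row_sum_le_linfty_opNorm (Matrix.pow_apply_nonneg hA m) i).trans hm2
  -- The vector is the truncated Neumann series v = (1 + A + ⋯ + A^(m-1)) 𝟙. It satisfies A v = v -
  -- 𝟙 + A^m 𝟙, which is at most v because the row sums of A^m are at most 1.
  refine ⟨fun i => ∑ l ∈ Finset.range m, ∑ j, (A ^ l) i j, fun i => ?_, fun i => ?_⟩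
  · calc (1 : ℝ) = ∑ j, (A ^ 0) i j := by simp [Matrix.one_apply]
      _ ≤ _ := Finset.single_le_sum (f := fun l => ∑ j, (A ^ l) i j)
        (fun l _ => Finset.sum_nonneg fun j _ => Matrix.pow_apply_nonneg hA l i j)
        (Finset.mem_range.2 hm1)
  · have h1 : ∑ j, A i j * ∑ l ∈ Finset.range m, ∑ k, (A ^ l) j k =
        ∑ l ∈ Finset.range m, ∑ k, (A ^ (l + 1)) i k := by
      simp_rw [pow_succ', Matrix.mul_apply, Finset.mul_sum]
      rw [Finset.sum_comm]
      exact Finset.sum_congr rfl fun l _ => Finset.sum_comm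
    rw [h1]
    have h2 := Finset.sum_range_succ (fun l => ∑ k, (A ^ l) i k) m
    rw [Finset.sum_range_succ'] at h2
    have h3 : ∑ k, (A ^ 0) i k = 1 := by simp [Matrix.one_apply]
    linarith [hr i]

/-- The row sums of the powers of a nonnegative matrix of spectral radius greater than one are
unbounded. -/
lemma exists_lt_row_sum_pow {A : Matrix n n ℝ} (hA : ∀ i j, 0 ≤ A i j) (h : 1 < realRadius A)
    (K : ℝ) : ∃ (m : ℕ) (i : n), K < ∑ j, (A ^ m) i j := by
  obtain ⟨m, hm⟩ := pow_unbounded_of_one_lt (max K 0) h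
  by_contra! hcon
  have h1 : ‖A ^ (m + 1)‖ ≤ max K 0 :=
    (linfty_opNorm_le_iff (le_max_right _ _) (Matrix.pow_apply_nonneg hA _)).2
      fun i => (hcon (m + 1) i).trans (le_max_left _ _)
  have h2 := realRadius_pow_le_norm_pow A m
  have h3 : realRadius A ^ m ≤ realRadius A ^ (m + 1) := pow_le_pow_right₀ h.le m.le_succ
  linarith

end PerronRadius

/-! ### Existence and uniqueness of the two exponents -/

/-- The two exponential bounds make log g Lipschitz with constant |log a| on [t₀, 1], so the
intermediate value theorem applies. -/
lemma exists_root_of_exponential_bounds {g : ℝ → ℝ} {a b : ℝ} (ha : 0 < a) (hb : 0 < b)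
    (hb1 : b < 1)
    (hl : ∀ t δ, 0 < t → 0 ≤ δ → a ^ δ * g t ≤ g (t + δ))
    (hu : ∀ t δ, 0 < t → 0 ≤ δ → g (t + δ) ≤ b ^ δ * g t)
    {t₀ : ℝ} (ht₀ : 0 < t₀) (ht₁ : t₀ < 1) (h0 : 1 < g t₀) (h1 : g 1 < 1) :
    ∃ t, 0 < t ∧ t < 1 ∧ g t = 1 := by
  have hpos : ∀ t, t₀ ≤ t → 0 < g t := fun t ht => by
    have := hl t₀ (t - t₀) ht₀ (by linarith)
    rw [add_sub_cancel] at this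
    exact lt_of_lt_of_le (by positivity) this
  have hlip : ∀ x ∈ Icc t₀ 1, ∀ y ∈ Icc t₀ 1, x ≤ y →
      |Real.log (g x) - Real.log (g y)| ≤ |Real.log a| * (y - x) := by
    intro x hx y hy hxy
    have hgx := hpos x hx.1
    have hgy := hpos y hy.1
    have e1 := hl x (y - x) (by linarith [hx.1]) (by linarith)
    have e2 := hu x (y - x) (by linarith [hx.1]) (by linarith)
    rw [add_sub_cancel] at e1 e2
    have l1 := Real.log_le_log (by positivity) e1
    have l2 := Real.log_le_log hgy e2
    rw [Real.log_mul (by positivity) hgx.ne', Real.log_rpow ha] at l1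
    rw [Real.log_mul (by positivity) hgx.ne', Real.log_rpow hb] at l2
    have l3 : Real.log b ≤ 0 := Real.log_nonpos hb.le hb1.le
    have l4 := neg_abs_le (Real.log a)
    rw [abs_le]
    constructor <;> nlinarith [abs_nonneg (Real.log a)]
  have hcont : ContinuousOn (fun t => Real.log (g t)) (Icc t₀ 1) := by
    refine (LipschitzOnWith.of_dist_le_mul (K := |Real.log a|.toNNReal)
      fun x hx y hy => ?_).continuousOn
    rw [Real.dist_eq, Real.dist_eq, Real.coe_toNNReal _ (abs_nonneg _)]
    rcases le_total x y with hxy | hxy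
    · rw [abs_sub_comm x y, abs_of_nonneg (sub_nonneg.2 hxy)]
      exact hlip x hx y hy hxy
    · rw [abs_sub_comm, abs_of_nonneg (sub_nonneg.2 hxy)]
      exact hlip y hy x hx hxy
  obtain ⟨t, ht, hgt⟩ := intermediate_value_Icc' ht₁.le hcont
    (show (0 : ℝ) ∈ Icc _ _ from ⟨Real.log_nonpos (hpos 1 ht₁.le).le h1.le, Real.log_nonneg h0.le⟩)
  have hg1 : g t = 1 := Real.eq_one_of_pos_of_log_eq_zero (hpos t ht.1) hgt
  refine ⟨t, ht₀.trans_le ht.1, lt_of_le_of_ne ht.2 ?_, hg1⟩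
  rintro rfl
  linarith

namespace BiLipschitzRIFS

variable {k N : ℕ} (I : BiLipschitzRIFS k N)

lemma nonempty_fin (I : BiLipschitzRIFS k N) : Nonempty (Fin N) :=
  ⟨⟨0, by have := I.two_le; omega⟩⟩

lemma P_nonneg (i j : Fin N) : 0 ≤ I.P i j := I.stochastic.1 i j

lemma sum_P (i : Fin N) : ∑ j, I.P i j = 1 := Matrix.sum_row_of_mem_rowStochastic I.stochastic i

lemma P_le_one (i j : Fin N) : I.P i j ≤ 1 :=
  I.sum_P i ▸ Finset.single_le_sum (fun j _ => I.P_nonneg i j) (Finset.mem_univ j)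

/-- The adjacency matrix of the graph of admissible transitions. -/
noncomputable def adjacency : Matrix (Fin N) (Fin N) ℝ :=
  Matrix.of fun i j => if 0 < I.P i j then 1 else 0

lemma adjacency_nonneg (i j : Fin N) : 0 ≤ I.adjacency i j := by
  simp only [adjacency, Matrix.of_apply]; split_ifs <;> norm_num

lemma P_le_adjacency (i j : Fin N) : I.P i j ≤ 1 * I.adjacency i j := by
  simp only [adjacency, Matrix.of_apply]
  split_ifs with h
  · simpa using I.P_le_one i j
  · linarith

/-- If every row had a single positive entry, P would be the 0-1 matrix of a self-map of the
letters. Irreducibility gives every column a positive entry, so that map would be surjective, hence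
a permutation. -/
lemma exists_two_successors (hP : ∀ σ : Equiv.Perm (Fin N), I.P ≠ σ.permMatrix ℝ) :
    ∃ i j j', j ≠ j' ∧ 0 < I.P i j ∧ 0 < I.P i j' := by
  by_contra! hcon
  have hN := I.two_le
  have : Nontrivial (Fin N) := Fin.nontrivial_iff_two_le.2 I.two_le
  choose g hg using I.exists_pos
  have huniq : ∀ i j, j ≠ g i → I.P i j = 0 := fun i j hj =>
    le_antisymm (hcon i (g i) j hj.symm (hg i)) (I.P_nonneg i j)
  have hone : ∀ i, I.P i (g i) = 1 := fun i => by
    rw [← I.sum_P i]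
    exact (Finset.sum_eq_single (g i) (fun j _ hj => huniq i j hj) (by simp)).symm
  have hsurj : Function.Surjective g := fun j => by
    obtain ⟨i, hi⟩ := I.irreducible.transpose.exists_pos j
    refine ⟨i, ?_⟩
    by_contra h
    rw [Matrix.transpose_apply, huniq i j (Ne.symm h)] at hi
    exact hi.false
  refine hP (Equiv.ofBijective g (Finite.injective_iff_bijective.1
    (Finite.injective_iff_surjective.2 hsurj))) ?_
  ext i j
  by_cases h : g i = j
  · subst h
    simp [hone, Equiv.Perm.permMatrix, PEquiv.toMatrix_apply]
  · rw [huniq i j (Ne.symm h)]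
    simp [Equiv.Perm.permMatrix, PEquiv.toMatrix_apply, h]

/-- Row sums of powers count admissible paths. Every letter has a successor, so the counts never
decrease in the length, and they grow whenever a path passes through the branching letter i. By
irreducibility i is reached from every letter. -/
lemma one_lt_realRadius_adjacency (hP : ∀ σ : Equiv.Perm (Fin N), I.P ≠ σ.permMatrix ℝ) :
    1 < realRadius I.adjacency := by
  have := I.nonempty_fin
  obtain ⟨i, j₁, j₂, hj, h1, h2⟩ := I.exists_two_successors hP
  have hrow : ∀ l, 1 ≤ ∑ j, I.adjacency l j := fun l => by
    rw [← I.sum_P l]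
    exact Finset.sum_le_sum fun j _ => by simpa using I.P_le_adjacency l j
  have hrow2 : 2 ≤ ∑ j, I.adjacency i j := by
    calc (2 : ℝ) = ∑ j ∈ {j₁, j₂}, I.adjacency i j := by
          rw [Finset.sum_pair hj]
          simp only [adjacency, Matrix.of_apply, h1, h2, if_true]
          norm_num
      _ ≤ _ := Finset.sum_le_sum_of_subset_of_nonneg (Finset.subset_univ _)
        fun j _ _ => I.adjacency_nonneg i j
  have hstep : ∀ m l, ∑ j, (I.adjacency ^ m) l j + (I.adjacency ^ m) l i ≤
      ∑ j, (I.adjacency ^ (m + 1)) l j := by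
    intro m l
    have e : ∑ j, (I.adjacency ^ (m + 1)) l j =
        ∑ k, (I.adjacency ^ m) l k * ∑ j, I.adjacency k j := by
      simp_rw [pow_succ, Matrix.mul_apply, Finset.mul_sum]
      exact Finset.sum_comm
    have e2 : (I.adjacency ^ m) l i = ∑ k, (I.adjacency ^ m) l k * (if k = i then 1 else 0) := by
      simp
    rw [e, e2, ← Finset.sum_add_distrib]
    refine Finset.sum_le_sum fun k _ => ?_
    rw [← mul_one_add]
    refine mul_le_mul_of_nonneg_left ?_ (Matrix.pow_apply_nonneg I.adjacency_nonneg m l k)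
    split_ifs with h
    · subst h; linarith
    · linarith [hrow k]
  have hmono : ∀ l, Monotone fun m => ∑ j, (I.adjacency ^ m) l j := fun l =>
    monotone_nat_of_le_succ fun m => by
      linarith [hstep m l, Matrix.pow_apply_nonneg I.adjacency_nonneg m l i]
  have hpath : ∀ l, ∃ m : ℕ, 0 < (I.adjacency ^ m) l i := fun l => by
    obtain ⟨m, -, hm⟩ :=
      (Matrix.isIrreducible_iff_exists_pow_pos I.irreducible.nonneg).1 I.irreducible l i
    refine ⟨m, hm.trans_le ?_⟩
    simpa using pow_entry_le zero_le_one I.P_nonneg I.adjacency_nonneg I.P_le_adjacency m l i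
  choose m hm using hpath
  obtain ⟨l₀, hl₀⟩ := Finite.exists_min fun l => (I.adjacency ^ m l) l i
  -- The exponent is a common length beyond every m l + 1, by which each starting letter has gained
  -- from branching at i; l₀ attains the least gain.
  refine one_lt_realRadius I.adjacency_nonneg (m := ∑ l, m l + 1)
    (b := 1 + (I.adjacency ^ m l₀) l₀ i) (by linarith [hm l₀]) fun l => ?_
  have h3 : ∑ j, (I.adjacency ^ 0) l j = 1 := by simp [Matrix.one_apply]
  calc 1 + (I.adjacency ^ m l₀) l₀ i
      ≤ ∑ j, (I.adjacency ^ m l) l j + (I.adjacency ^ m l) l i := by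
        have := hmono l (Nat.zero_le (m l))
        simp only [h3] at this
        exact add_le_add this (hl₀ l)
    _ ≤ ∑ j, (I.adjacency ^ (m l + 1)) l j := hstep _ _
    _ ≤ _ := hmono l (Nat.succ_le_succ
        (Finset.single_le_sum (fun l _ => Nat.zero_le (m l)) (Finset.mem_univ l)))

/-- The weights `p_ij a_ij^r`. -/
noncomputable def edgeWeight (a : Fin N → Fin N → ℝ) (r : ℝ) (i j : Fin N) : ℝ :=
  I.P i j * a i j ^ r

/-- The matrix `[(p_ij a_ij^r)^t]`. -/
noncomputable def pressureMatrix (a : Fin N → Fin N → ℝ) (r t : ℝ) : Matrix (Fin N) (Fin N) ℝ :=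
  Matrix.of fun i j => I.edgeWeight a r i j ^ t

lemma upperRadius_eq_one_iff (r t : ℝ) :
    I.upperRadius r t = 1 ↔ realRadius (I.pressureMatrix I.s r t) = 1 :=
  spectralRadius_map_ofReal_eq_one_iff _

lemma lowerRadius_eq_one_iff (r t : ℝ) :
    I.lowerRadius r t = 1 ↔ realRadius (I.pressureMatrix I.c r t) = 1 :=
  spectralRadius_map_ofReal_eq_one_iff _

section

variable {a : Fin N → Fin N → ℝ} {r : ℝ}

lemma edgeWeight_nonneg (ha : ∀ i j, 0 < a i j) (i j : Fin N) :
    0 ≤ I.edgeWeight a r i j :=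
  mul_nonneg (I.P_nonneg i j) (Real.rpow_nonneg (ha i j).le r)

lemma edgeWeight_pos (ha : ∀ i j, 0 < a i j) {i j : Fin N} (h : 0 < I.P i j) :
    0 < I.edgeWeight a r i j :=
  mul_pos h (Real.rpow_pos_of_pos (ha i j) r)

lemma edgeWeight_eq_zero {i j : Fin N} (h : ¬ 0 < I.P i j) : I.edgeWeight a r i j = 0 := by
  rw [edgeWeight, le_antisymm (not_lt.1 h) (I.P_nonneg i j), zero_mul]

lemma pressureMatrix_nonneg (ha : ∀ i j, 0 < a i j) (t : ℝ) (i j : Fin N) :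
    0 ≤ I.pressureMatrix a r t i j :=
  Real.rpow_nonneg (I.edgeWeight_nonneg ha i j) t

/-- The factor `I.P i j` is kept in the upper bound so that the row sums at t = 1 are at most b. -/
lemma exists_edgeWeight_bounds (ha : ∀ i j, 0 < a i j) (ha1 : ∀ i j, a i j < 1) (hr : 0 < r) :
    ∃ q b : ℝ, 0 < q ∧ q < 1 ∧ 0 < b ∧ b < 1 ∧
      (∀ i j, I.edgeWeight a r i j ≤ I.P i j * b) ∧
      (∀ i j, 0 < I.P i j → q ≤ I.edgeWeight a r i j) := by
  have := I.nonempty_fin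
  have : Nonempty {x : Fin N × Fin N // 0 < I.P x.1 x.2} := by
    obtain ⟨j, hj⟩ := I.exists_pos (Classical.arbitrary _)
    exact ⟨⟨(_, j), hj⟩⟩
  obtain ⟨x, hx⟩ := Finite.exists_max fun x : Fin N × Fin N => a x.1 x.2 ^ r
  obtain ⟨y, hy⟩ := Finite.exists_min
    fun y : {x : Fin N × Fin N // 0 < I.P x.1 x.2} => I.edgeWeight a r y.1.1 y.1.2
  have hb1 : a x.1 x.2 ^ r < 1 := Real.rpow_lt_one (ha _ _).le (ha1 _ _) hr
  have hb : ∀ i j, I.edgeWeight a r i j ≤ I.P i j * a x.1 x.2 ^ r := fun i j =>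
    mul_le_mul_of_nonneg_left (hx (i, j)) (I.P_nonneg i j)
  have hx0 : 0 < a x.1 x.2 ^ r := Real.rpow_pos_of_pos (ha _ _) r
  refine ⟨_, _, I.edgeWeight_pos ha y.2, ?_, hx0, hb1, hb, fun i j h => hy ⟨(i, j), h⟩⟩
  exact (hb _ _).trans_lt (by nlinarith [I.P_le_one y.1.1 y.1.2])

lemma realRadius_pressureMatrix_add_le (ha : ∀ i j, 0 < a i j) {b : ℝ} (hb : 0 < b)
    (h : ∀ i j, I.edgeWeight a r i j ≤ I.P i j * b) {t δ : ℝ} (ht : 0 < t) (hδ : 0 ≤ δ) :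
    realRadius (I.pressureMatrix a r (t + δ)) ≤ b ^ δ * realRadius (I.pressureMatrix a r t) := by
  have := I.nonempty_fin
  refine realRadius_le_mul (by positivity) (I.pressureMatrix_nonneg ha _)
    (I.pressureMatrix_nonneg ha _) fun i j => ?_
  have h0 := I.edgeWeight_nonneg (r := r) ha i j
  simp only [pressureMatrix, Matrix.of_apply]
  rw [Real.rpow_add_of_nonneg h0 ht.le hδ, mul_comm]
  have hb' : I.edgeWeight a r i j ≤ b := (h i j).trans (by nlinarith [I.P_le_one i j])
  gcongr

lemma le_realRadius_pressureMatrix_add (ha : ∀ i j, 0 < a i j) {q : ℝ} (hq : 0 < q)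
    (h : ∀ i j, 0 < I.P i j → q ≤ I.edgeWeight a r i j) {t δ : ℝ} (ht : 0 < t) (hδ : 0 ≤ δ) :
    q ^ δ * realRadius (I.pressureMatrix a r t) ≤ realRadius (I.pressureMatrix a r (t + δ)) := by
  have := I.nonempty_fin
  have hqd : 0 < q ^ δ := by positivity
  have key : realRadius (I.pressureMatrix a r t) ≤
      (q ^ δ)⁻¹ * realRadius (I.pressureMatrix a r (t + δ)) := by
    refine realRadius_le_mul (by positivity) (I.pressureMatrix_nonneg ha _)
      (I.pressureMatrix_nonneg ha _) fun i j => ?_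
    have h0 := I.edgeWeight_nonneg (r := r) ha i j
    rw [← div_eq_inv_mul, le_div_iff₀ hqd]
    simp only [pressureMatrix, Matrix.of_apply]
    by_cases hp : 0 < I.P i j
    · rw [Real.rpow_add_of_nonneg h0 ht.le hδ]
      have := h i j hp
      gcongr
    -- A forbidden transition stays a zero entry because both exponents are positive; at exponent 0
    -- it would become 1.
    · rw [I.edgeWeight_eq_zero hp, Real.zero_rpow ht.ne', Real.zero_rpow (by linarith)]
      simp
  rwa [← div_eq_inv_mul, le_div_iff₀' hqd] at key

/-- At t = 1 the row sums are at most b < 1. For small t the matrix dominates q^t times the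
adjacency matrix, whose radius exceeds 1. -/
lemma exists_root_realRadius_pressureMatrix
    (hP : ∀ σ : Equiv.Perm (Fin N), I.P ≠ σ.permMatrix ℝ)
    (ha : ∀ i j, 0 < a i j) (ha1 : ∀ i j, a i j < 1) (hr : 0 < r) :
    ∃ t, 0 < t ∧ t < 1 ∧ realRadius (I.pressureMatrix a r t) = 1 := by
  have := I.nonempty_fin
  obtain ⟨q, b, hq, hq1, hb, hb1, hub, hlb⟩ := I.exists_edgeWeight_bounds ha ha1 hr
  have hR := I.one_lt_realRadius_adjacency hP
  have hlow : ∀ t, 0 < t →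
      q ^ t * realRadius I.adjacency ≤ realRadius (I.pressureMatrix a r t) := by
    intro t ht
    have hqt : 0 < q ^ t := by positivity
    have key : realRadius I.adjacency ≤ (q ^ t)⁻¹ * realRadius (I.pressureMatrix a r t) := by
      refine realRadius_le_mul (by positivity) I.adjacency_nonneg
        (I.pressureMatrix_nonneg ha _) fun i j => ?_
      rw [← div_eq_inv_mul, le_div_iff₀ hqt]
      simp only [pressureMatrix, adjacency, Matrix.of_apply]
      split_ifs with hp
      · rw [one_mul]
        have := hlb i j hp
        gcongr
      · rw [zero_mul]
        exact Real.rpow_nonneg (I.edgeWeight_nonneg ha i j) t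
    rwa [← div_eq_inv_mul, le_div_iff₀' hqt] at key
  have hlim : Tendsto (fun t : ℝ => q ^ t * realRadius I.adjacency) (𝓝[>] 0)
      (𝓝 (q ^ (0 : ℝ) * realRadius I.adjacency)) :=
    (((Real.continuous_const_rpow hq.ne').tendsto 0).mul_const _).mono_left nhdsWithin_le_nhds
  rw [Real.rpow_zero, one_mul] at hlim
  obtain ⟨t₀, h0, ht₀⟩ := ((hlim.eventually_const_lt hR).and
    (Ioo_mem_nhdsGT (zero_lt_one' ℝ))).exists
  refine exists_root_of_exponential_bounds hq hb hb1
    (fun t δ => I.le_realRadius_pressureMatrix_add ha hq hlb)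
    (fun t δ => I.realRadius_pressureMatrix_add_le ha hb hub) ht₀.1 ht₀.2
    (h0.trans_le (hlow _ ht₀.1)) ((realRadius_le_of_row_sum_le hb.le
      (I.pressureMatrix_nonneg ha _) fun i => ?_).trans_lt hb1)
  simp only [pressureMatrix, Matrix.of_apply, Real.rpow_one]
  calc ∑ j, I.edgeWeight a r i j ≤ ∑ j, I.P i j * b := Finset.sum_le_sum fun j _ => hub i j
    _ = b := by rw [← Finset.sum_mul, I.sum_P, one_mul]

/-- The spectral radius of `[(p_ij a_ij^r)^t]` is strictly decreasing. -/
lemma realRadius_pressureMatrix_lt (ha : ∀ i j, 0 < a i j) (ha1 : ∀ i j, a i j < 1) (hr : 0 < r)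
    {t t' : ℝ} (ht : 0 < t) (htt' : t < t') (h : 0 < realRadius (I.pressureMatrix a r t')) :
    realRadius (I.pressureMatrix a r t') < realRadius (I.pressureMatrix a r t) := by
  obtain ⟨q, b, -, -, hb, hb1, hub, -⟩ := I.exists_edgeWeight_bounds ha ha1 hr
  have key := I.realRadius_pressureMatrix_add_le ha hb hub ht (sub_nonneg.2 htt'.le)
  rw [add_sub_cancel] at key
  have hlt : b ^ (t' - t) < 1 := Real.rpow_lt_one hb.le hb1 (sub_pos.2 htt')
  have hpos : 0 < b ^ (t' - t) := by positivity
  have h' : 0 < realRadius (I.pressureMatrix a r t) := by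
    by_contra! hle
    nlinarith
  nlinarith

lemma existsUnique_realRadius_pressureMatrix_eq_one
    (hP : ∀ σ : Equiv.Perm (Fin N), I.P ≠ σ.permMatrix ℝ)
    (ha : ∀ i j, 0 < a i j) (ha1 : ∀ i j, a i j < 1) (hr : 0 < r) :
    ∃! u : ℝ, 0 < u ∧ realRadius (I.pressureMatrix a r (u / (r + u))) = 1 := by
  obtain ⟨t, ht, ht1, h⟩ := I.exists_root_realRadius_pressureMatrix hP ha ha1 hr
  have hne : ∀ s s', 0 < s → s < s' → realRadius (I.pressureMatrix a r s) = 1 →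
      realRadius (I.pressureMatrix a r s') ≠ 1 := by
    intro s s' hs hss h1 h2
    have := I.realRadius_pressureMatrix_lt ha ha1 hr hs hss (by rw [h2]; norm_num)
    linarith
  have h1t : 0 < 1 - t := by linarith
  -- This is the solution u of u/(r+u) = t.
  refine ⟨r * t / (1 - t), ⟨by positivity, ?_⟩, fun u ⟨hu, hu1⟩ => ?_⟩
  · have e : r * t / (1 - t) / (r + r * t / (1 - t)) = t := by
      field_simp
      ring
    simp only [e, h]
  · have e : u / (r + u) = t := by
      have hs : 0 < u / (r + u) := by positivity
      rcases lt_trichotomy (u / (r + u)) t with hlt | heq | hlt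
      · exact absurd h (hne _ _ hs hlt hu1)
      · exact heq
      · exact absurd hu1 (hne _ _ ht hlt h)
    have e2 : 1 - u / (r + u) = r / (r + u) := by
      field_simp
      ring
    rw [← e, e2]
    field_simp

end

end BiLipschitzRIFS

namespace BiLipschitzRIFS

variable {k N : ℕ} (I : BiLipschitzRIFS k N)

/-! ### Finite words -/

/-- The last letter of the word `i :: l`. -/
def endpoint : Fin N → List (Fin N) → Fin N
  | i, [] => i
  | _, j :: l => endpoint j l

/-- The composition of the maps along the word `i :: l`. -/
def branch : Fin N → List (Fin N) → I.X → I.X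
  | _, [] => id
  | i, j :: l => I.f i j ∘ branch j l

/-- The product of the entries of `a` along the word `i :: l`. -/
def weight (a : Fin N → Fin N → ℝ) : Fin N → List (Fin N) → ℝ
  | _, [] => 1
  | i, j :: l => a i j * weight a j l

/-- An infinite sequence that starts with the word `i :: l`. -/
def wordSeq : Fin N → List (Fin N) → ℕ → Fin N
  | i, [] => fun _ => i
  | i, j :: l => fun n => Nat.casesOn n i (wordSeq j l)

lemma endpoint_append (i : Fin N) (l m : List (Fin N)) :
    endpoint i (l ++ m) = endpoint (endpoint i l) m := by
  induction l generalizing i with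
  | nil => rfl
  | cons j l ih => exact ih j

lemma branch_append (i : Fin N) (l m : List (Fin N)) :
    I.branch i (l ++ m) = I.branch i l ∘ I.branch (endpoint i l) m := by
  induction l generalizing i with
  | nil => rfl
  | cons j l ih => exact congrArg (I.f i j ∘ ·) (ih j)

lemma weight_append (a : Fin N → Fin N → ℝ) (i : Fin N) (l m : List (Fin N)) :
    weight a i (l ++ m) = weight a i l * weight a (endpoint i l) m := by
  induction l generalizing i with
  | nil => simp [weight, endpoint]
  | cons j l ih => simp [weight, endpoint, ih, mul_assoc]

lemma weight_nonneg {a : Fin N → Fin N → ℝ} (ha : ∀ i j, 0 ≤ a i j) (i : Fin N)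
    (l : List (Fin N)) : 0 ≤ weight a i l := by
  induction l generalizing i with
  | nil => exact zero_le_one
  | cons j l ih => exact mul_nonneg (ha i j) (ih j)

lemma weight_pos {a : Fin N → Fin N → ℝ} (ha : ∀ i j, 0 < a i j) (i : Fin N)
    (l : List (Fin N)) : 0 < weight a i l := by
  induction l generalizing i with
  | nil => exact zero_lt_one
  | cons j l ih => exact mul_pos (ha i j) (ih j)

lemma weight_le_one {a : Fin N → Fin N → ℝ} (ha : ∀ i j, 0 ≤ a i j) (ha1 : ∀ i j, a i j ≤ 1)
    (i : Fin N) (l : List (Fin N)) : weight a i l ≤ 1 := by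
  induction l generalizing i with
  | nil => exact le_rfl
  | cons j l ih => exact mul_le_one₀ (ha1 i j) (weight_nonneg ha j l) (ih j)

lemma weight_edgeWeight {a : Fin N → Fin N → ℝ} (ha : ∀ i j, 0 ≤ a i j) (r : ℝ) (i : Fin N)
    (l : List (Fin N)) :
    weight (I.edgeWeight a r) i l = weight (fun i j => I.P i j) i l * weight a i l ^ r := by
  induction l generalizing i with
  | nil => simp [weight]
  | cons j l ih =>
    calc weight (I.edgeWeight a r) i (j :: l)
        = I.P i j * a i j ^ r * weight (I.edgeWeight a r) j l := rfl
      _ = I.P i j * weight (fun i j => I.P i j) j l * (a i j ^ r * weight a j l ^ r) := by rw [ih]; ring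
      _ = weight (fun i j => I.P i j) i (j :: l) * weight a i (j :: l) ^ r := by
        rw [← Real.mul_rpow (ha i j) (weight_nonneg ha j l)]
        rfl

lemma c_le_one (i j : Fin N) : I.c i j ≤ 1 := (I.c_le_s i j).trans (I.s_lt_one i j).le

lemma s_pos (i j : Fin N) : 0 < I.s i j := (I.c_pos i j).trans_le (I.c_le_s i j)

lemma weight_c_mul_dist_le (i : Fin N) (l : List (Fin N)) (x y : I.X) :
    weight I.c i l * dist x y ≤ dist (I.branch i l x) (I.branch i l y) := by
  induction l generalizing i with
  | nil => simp [weight, branch]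
  | cons j l ih =>
    rw [weight, mul_assoc]
    exact (mul_le_mul_of_nonneg_left (ih j) (I.c_pos i j).le).trans (I.lower_bound i j _ _)

lemma dist_branch_le (i : Fin N) (l : List (Fin N)) (x y : I.X) :
    dist (I.branch i l x) (I.branch i l y) ≤ weight I.s i l * dist x y := by
  induction l generalizing i with
  | nil => simp [weight, branch]
  | cons j l ih =>
    rw [weight, mul_assoc]
    exact (I.upper_bound i j _ _).trans (mul_le_mul_of_nonneg_left (ih j) (I.s_pos i j).le)

lemma continuous_branch (i : Fin N) (l : List (Fin N)) : Continuous (I.branch i l) := by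
  obtain ⟨K, -, hf⟩ := I.exists_ratio
  induction l generalizing i with
  | nil => exact continuous_id
  | cons j l ih => exact (hf i j).continuous.comp (ih j)

lemma injective_f (i j : Fin N) : Function.Injective (I.f i j) := fun x y h => by
  have h1 := I.lower_bound i j x y
  rw [h, dist_self] at h1
  have h2 := I.c_pos i j
  exact dist_le_zero.1 (by nlinarith [dist_nonneg (x := x) (y := y)])

lemma wordSeq_zero (i : Fin N) (l : List (Fin N)) : wordSeq i l 0 = i := by
  cases l <;> rfl

lemma prod_wordSeq (a : Fin N → Fin N → ℝ) (i : Fin N) (l : List (Fin N)) :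
    ∏ n ∈ Finset.range l.length, a (wordSeq i l n) (wordSeq i l (n + 1)) = weight a i l := by
  induction l generalizing i with
  | nil => rfl
  | cons j l ih =>
    rw [List.length_cons, Finset.prod_range_succ', weight, ← ih j, mul_comm]
    congr 1
    simp [wordSeq, wordSeq_zero]

/-- The sequence `τ` starts with the word `i :: l`. -/
def HasPrefix (τ : ℕ → Fin N) (i : Fin N) (l : List (Fin N)) : Prop :=
  ∀ n ≤ l.length, τ n = wordSeq i l n

lemma hasPrefix_nil_iff {τ : ℕ → Fin N} {i : Fin N} : HasPrefix τ i [] ↔ τ 0 = i := by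
  simp [HasPrefix, wordSeq]

lemma hasPrefix_cons_iff {τ : ℕ → Fin N} {i j : Fin N} {l : List (Fin N)} :
    HasPrefix τ i (j :: l) ↔ τ 0 = i ∧ HasPrefix (fun n => τ (n + 1)) j l := by
  constructor
  · intro h
    exact ⟨h 0 (Nat.zero_le _), fun n hn => h (n + 1) (Nat.succ_le_succ hn)⟩
  · rintro ⟨h0, h⟩ (_ | n) hn
    · exact h0
    · exact h n (Nat.le_of_succ_le_succ hn)

/-- The cylinder of the word `i :: l`. -/
def cylinder (i : Fin N) (l : List (Fin N)) : Set I.CodeSpace := {τ | HasPrefix τ.1 i l}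

lemma isMarkovMeasure_markovMeasure : I.IsMarkovMeasure I.markovMeasure :=
  I.existsUnique_isMarkovMeasure.choose_spec.1

instance : IsProbabilityMeasure I.markovMeasure := I.isMarkovMeasure_markovMeasure.1

instance : IsProbabilityMeasure I.limitMeasure :=
  Measure.isProbabilityMeasure_map I.measurable_coding.aemeasurable

lemma markovMeasure_cylinder (i : Fin N) (l : List (Fin N)) :
    I.markovMeasure (I.cylinder i l) = ENNReal.ofReal (I.stationary i * weight (fun i j => I.P i j) i l) := by
  rw [← prod_wordSeq (fun i j => I.P i j) i l]
  have h := I.isMarkovMeasure_markovMeasure.2 (wordSeq i l) l.length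
  rw [wordSeq_zero] at h
  exact h

lemma stationary_pos (i : Fin N) : 0 < I.stationary i := by
  have h := I.isStationary_stationary
  refine (h.1 i).lt_of_ne fun h0 => ?_
  have h1 := h.2.1
  rw [I.eq_zero_of_vecMul_eq h.1 h.2.2 h0.symm] at h1
  simp at h1

/-- `wordMap` grows on the inside of the composition and `branch` on the outside; this identity
reconciles the two recursions. -/
lemma wordMap_succ' (w : ℕ → Fin N) (n : ℕ) :
    I.wordMap w (n + 1) = I.f (w 0) (w 1) ∘ I.wordMap (fun m => w (m + 1)) n := by
  induction n with
  | zero => rfl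
  | succ n ih =>
    rw [wordMap, ih]
    rfl

lemma wordMap_eq_branch {τ : ℕ → Fin N} {i : Fin N} {l : List (Fin N)} (h : HasPrefix τ i l) :
    I.wordMap τ l.length = I.branch i l := by
  induction l generalizing i τ with
  | nil => rfl
  | cons j l ih =>
    obtain ⟨h0, h1⟩ := hasPrefix_cons_iff.1 h
    have h2 : τ 1 = j := (h1 0 (Nat.zero_le _)).trans (wordSeq_zero j l)
    rw [List.length_cons, wordMap_succ', ih h1, h0, h2]
    rfl

lemma coding_mem_range_branch {τ : I.CodeSpace} {i : Fin N} {l : List (Fin N)}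
    (h : τ ∈ I.cylinder i l) : I.coding τ ∈ range (I.branch i l) := by
  cases l with
  | nil => exact ⟨_, rfl⟩
  | cons j l =>
    have h1 := (I.existsUnique_coding τ).choose_spec.1 (j :: l).length (by simp)
    rw [I.wordMap_eq_branch h] at h1
    exact image_subset_range _ _ h1

/-- The image of `X` under the branch of the word `i :: l`, as a subset of the Euclidean space. -/
def piece (i : Fin N) (l : List (Fin N)) : Set (EuclideanSpace ℝ (Fin k)) :=
  range fun x => (I.branch i l x : EuclideanSpace ℝ (Fin k))

lemma isCompact_piece (i : Fin N) (l : List (Fin N)) : IsCompact (I.piece i l) := by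
  have : CompactSpace I.X := isCompact_iff_compactSpace.1 I.isCompact
  exact isCompact_range (continuous_subtype_val.comp (I.continuous_branch i l))

lemma coding_mem_piece {τ : I.CodeSpace} {i : Fin N} {l : List (Fin N)}
    (h : τ ∈ I.cylinder i l) : (I.coding τ : EuclideanSpace ℝ (Fin k)) ∈ I.piece i l := by
  obtain ⟨x, hx⟩ := I.coding_mem_range_branch h
  exact ⟨x, congrArg Subtype.val hx⟩

/-- Only an inequality, since points coded by other cylinders may also lie in the piece. The lower
bound on the error needs no more. -/
lemma le_limitMeasure_piece (i : Fin N) (l : List (Fin N)) :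
    ENNReal.ofReal (I.stationary i * weight (fun i j => I.P i j) i l) ≤ I.limitMeasure (I.piece i l) := by
  rw [← I.markovMeasure_cylinder, limitMeasure,
    Measure.map_apply I.measurable_coding (I.isCompact_piece i l).measurableSet]
  exact measure_mono fun τ hτ => I.coding_mem_piece hτ

end BiLipschitzRIFS

/-! ### Upper bound for the quantization error -/

lemma quantizationError_antitone {k : ℕ} (μ : Measure (EuclideanSpace ℝ (Fin k))) (r : ℝ) :
    Antitone (quantizationError μ r) := fun _ _ hmn =>
  le_iInf₂ fun A hA => iInf₂_le_of_le A (hA.trans hmn) le_rfl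

/-- Deleting a first edge of weight q rescales the threshold x to x/q. This identity and the next
one isolate the factor q^t, which is the entry of the pressure matrix. -/
lemma div_rpow_neg_eq {x q : ℝ} (hx : 0 < x) (hq : 0 < q) (t : ℝ) :
    (x / q) ^ (-t) = x ^ (-t) * q ^ t := by
  rw [Real.div_rpow hx.le hq.le, Real.rpow_neg hq.le, div_inv_eq_mul]

lemma mul_div_rpow_one_sub_eq {x q : ℝ} (hx : 0 < x) (hq : 0 < q) (t : ℝ) :
    q * (x / q) ^ (1 - t) = x ^ (1 - t) * q ^ t := by
  rw [sub_eq_add_neg, Real.rpow_add (div_pos hx hq), div_rpow_neg_eq hx hq, Real.rpow_one,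
    Real.rpow_add hx, Real.rpow_one]
  field_simp

namespace BiLipschitzRIFS

variable {k N : ℕ} (I : BiLipschitzRIFS k N)

/-- A covering of the admissible sequences from `i` by finitely many words, which are short or
long according to a threshold `ε` for their weights. -/
lemma exists_covering_words {a : Fin N → Fin N → ℝ} {r t q b : ℝ} (ha : ∀ i j, 0 < a i j)
    (ht : 0 < t) (ht1 : t < 1) (hq : 0 < q) (hq1 : q < 1) (hb : 0 < b)
    (hub : ∀ i j, I.edgeWeight a r i j ≤ b)
    (hlb : ∀ i j, 0 < I.P i j → q ≤ I.edgeWeight a r i j)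
    {h : Fin N → ℝ} (h1 : ∀ i, 1 ≤ h i) (hh : ∀ i, ∑ j, I.pressureMatrix a r t i j * h j ≤ h i)
    (m : ℕ) (ε : ℝ) (hε : b ^ m ≤ ε) (hε1 : ε ≤ q⁻¹) (i : Fin N) :
    ∃ (ι : Type) (_ : Fintype ι) (σ : ι → List (Fin N)),
      (∀ τ : ℕ → Fin N, (∀ n, 0 < I.P (τ n) (τ (n + 1))) → τ 0 = i → ∃ x, HasPrefix τ i (σ x)) ∧
      (Fintype.card ι : ℝ) ≤ q⁻¹ * h i * ε ^ (-t) ∧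
      ∑ x, weight (I.edgeWeight a r) i (σ x) ≤ q⁻¹ * h i * ε ^ (1 - t) := by
  -- Once the threshold has reached 1 the empty word suffices. The overshoot is at most q⁻¹, which
  -- the factor q⁻¹ in the bounds absorbs.
  have base : ∀ ε i, 1 ≤ ε → ε ≤ q⁻¹ → ∃ (ι : Type) (_ : Fintype ι) (σ : ι → List (Fin N)),
      (∀ τ : ℕ → Fin N, (∀ n, 0 < I.P (τ n) (τ (n + 1))) → τ 0 = i → ∃ x, HasPrefix τ i (σ x)) ∧
      (Fintype.card ι : ℝ) ≤ q⁻¹ * h i * ε ^ (-t) ∧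
      ∑ x, weight (I.edgeWeight a r) i (σ x) ≤ q⁻¹ * h i * ε ^ (1 - t) := by
    intro ε i hε hε1
    have hqi : 1 ≤ q⁻¹ := (one_le_inv₀ hq).2 hq1.le
    have hε0 : 0 < ε := by linarith
    refine ⟨Unit, inferInstance, fun _ => [], fun τ _ h0 => ⟨(), hasPrefix_nil_iff.2 h0⟩, ?_, ?_⟩
    · have e1 : ε ^ t ≤ q⁻¹ := by
        calc ε ^ t ≤ ε ^ (1 : ℝ) := Real.rpow_le_rpow_of_exponent_le hε ht1.le
          _ ≤ q⁻¹ := by rwa [Real.rpow_one]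
      rw [Real.rpow_neg hε0.le, ← div_eq_mul_inv, le_div_iff₀ (by positivity)]
      simp only [Fintype.card_unit, Nat.cast_one, one_mul]
      nlinarith [h1 i]
    · have e1 : 1 ≤ ε ^ (1 - t) := Real.one_le_rpow hε (by linarith)
      have e2 : 1 ≤ q⁻¹ * h i := one_le_mul_of_one_le_of_one_le hqi (h1 i)
      simp only [weight, Finset.univ_unique, Finset.sum_const, Finset.card_singleton, one_smul]
      exact one_le_mul_of_one_le_of_one_le e2 e1
  -- The number m bounds the remaining depth: since Q ≤ b, the inequality b^(m+1) ≤ ε passes to b^m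
  -- ≤ ε/Q for the tail.
  induction m generalizing ε i with
  | zero => exact base ε i (by simpa using hε) hε1
  | succ m ih =>
    rcases le_or_gt 1 ε with hle | hlt
    · exact base ε i hle hε1
    have hε0 : 0 < ε := lt_of_lt_of_le (by positivity) hε
    let J : Type := {j // 0 < I.P i j}
    let Q : J → ℝ := fun j => I.edgeWeight a r i j.1
    have hQ : ∀ j, 0 < Q j := fun j => I.edgeWeight_pos ha j.2
    choose ι hι σ hcov hcard hsum using fun j : J => ih (ε / Q j) (by
      rw [le_div_iff₀ (hQ j)]
      refine le_trans ?_ hε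
      rw [pow_succ]
      gcongr
      exact hub i j.1) (by
      rw [div_le_iff₀ (hQ j)]
      have := hlb i j.1 j.2
      have e : q⁻¹ * q ≤ q⁻¹ * Q j := by gcongr
      rw [inv_mul_cancel₀ hq.ne'] at e
      linarith) j.1
    -- Subinvariance of h, restricted to admissible edges, closes the induction for both the count
    -- and the total weight.
    have hJ : ∑ j : J, Q j ^ t * h j.1 ≤ h i := by
      classical
      refine le_trans ?_ (hh i)
      have e := Finset.sum_subtype (Finset.univ.filter fun j => 0 < I.P i j)
        (p := fun j => 0 < I.P i j) (F := (inferInstance : Fintype J)) (by simp) fun j => I.pressureMatrix a r t i j * h j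
      refine (Eq.le ?_).trans (Finset.sum_le_sum_of_subset_of_nonneg
        (Finset.filter_subset (fun j => 0 < I.P i j) _) fun j _ _ =>
        mul_nonneg (I.pressureMatrix_nonneg ha t i j) (zero_le_one.trans (h1 j)))
      rw [e]
      rfl
    refine ⟨Σ j : J, ι j, inferInstance, fun x => x.1.1 :: σ x.1 x.2, ?_, ?_, ?_⟩
    · intro τ hτ h0
      have hp : 0 < I.P i (τ 1) := by
        have := hτ 0
        rwa [h0] at this
      obtain ⟨x, hx⟩ := hcov ⟨τ 1, hp⟩ (fun n => τ (n + 1)) (fun n => hτ (n + 1)) rfl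
      exact ⟨⟨⟨τ 1, hp⟩, x⟩, hasPrefix_cons_iff.2 ⟨h0, hx⟩⟩
    · rw [Fintype.card_sigma]
      push_cast
      calc ∑ j : J, (Fintype.card (ι j) : ℝ) ≤ ∑ j : J, q⁻¹ * h j.1 * (ε / Q j) ^ (-t) :=
            Finset.sum_le_sum fun j _ => hcard j
        _ = q⁻¹ * (∑ j : J, Q j ^ t * h j.1) * ε ^ (-t) := by
            rw [Finset.mul_sum, Finset.sum_mul]
            refine Finset.sum_congr rfl fun j _ => ?_
            rw [div_rpow_neg_eq hε0 (hQ j)]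
            ring
        _ ≤ q⁻¹ * h i * ε ^ (-t) := by gcongr
    · rw [Fintype.sum_sigma]
      calc ∑ j : J, ∑ x, weight (I.edgeWeight a r) i (j.1 :: σ j x)
          ≤ ∑ j : J, Q j * (q⁻¹ * h j.1 * (ε / Q j) ^ (1 - t)) := by
            refine Finset.sum_le_sum fun j _ => ?_
            simp only [weight]
            rw [← Finset.mul_sum]
            exact mul_le_mul_of_nonneg_left (hsum j) (hQ j).le
        _ = q⁻¹ * (∑ j : J, Q j ^ t * h j.1) * ε ^ (1 - t) := by
            rw [Finset.mul_sum, Finset.sum_mul]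
            refine Finset.sum_congr rfl fun j _ => ?_
            rw [show Q j * (q⁻¹ * h j.1 * (ε / Q j) ^ (1 - t)) =
              q⁻¹ * h j.1 * (Q j * (ε / Q j) ^ (1 - t)) by ring,
              mul_div_rpow_one_sub_eq hε0 (hQ j)]
            ring
        _ ≤ q⁻¹ * h i * ε ^ (1 - t) := by gcongr

/-- A family of words that covers the code space bounds a quantization error. -/
lemma quantizationError_le_of_cover {ι : Type} [Fintype ι] (i : ι → Fin N)
    (σ : ι → List (Fin N)) (hcov : ∀ τ : I.CodeSpace, ∃ x, τ ∈ I.cylinder (i x) (σ x))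
    {r D : ℝ} (hr : 0 < r) (hD0 : 0 ≤ D) (hD : ∀ x y : I.X, dist x y ≤ D) :
    quantizationError I.limitMeasure r (Fintype.card ι) ≤
      ENNReal.ofReal (D ^ r * ∑ x, weight (I.edgeWeight I.s r) (i x) (σ x)) := by
  classical
  obtain ⟨x₀⟩ := I.nonempty.to_subtype
  -- The centres are the images of one fixed point of X, one in each piece.
  let y : ι → EuclideanSpace ℝ (Fin k) := fun x => I.branch (i x) (σ x) x₀
  let A : Finset (EuclideanSpace ℝ (Fin k)) := Finset.univ.image y
  have hs0 := fun i j => (I.s_pos i j).le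
  refine (iInf₂_le A (Finset.card_image_le.trans_eq Finset.card_univ)).trans ?_
  rw [limitMeasure, lintegral_map (by fun_prop) I.measurable_coding]
  have hmeas : ∀ x, MeasurableSet (I.cylinder (i x) (σ x)) := fun x => by
    have : I.cylinder (i x) (σ x) = ⋂ n ∈ Set.Iic (σ x).length,
        (fun τ : I.CodeSpace => τ.1 n) ⁻¹' {wordSeq (i x) (σ x) n} := by
      ext; simp [cylinder, HasPrefix]
    rw [this]
    exact MeasurableSet.biInter (Set.to_countable _) fun n _ =>
      ((measurable_pi_apply n).comp measurable_subtype_coe) (measurableSet_singleton _)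
  -- The cylinders may overlap; a sum of indicators still dominates the distance, since some term
  -- does.
  have hpt : ∀ τ : I.CodeSpace, Metric.infEDist (I.coding τ : EuclideanSpace ℝ (Fin k)) A ^ r ≤
      ∑ x, (I.cylinder (i x) (σ x)).indicator
        (fun _ => ENNReal.ofReal ((weight I.s (i x) (σ x) * D) ^ r)) τ := by
    intro τ
    obtain ⟨x, hx⟩ := hcov τ
    obtain ⟨z, hz⟩ := I.coding_mem_range_branch hx
    refine le_trans ?_ (Finset.single_le_sum (fun _ _ => zero_le) (Finset.mem_univ x))
    rw [indicator_of_mem hx, ← ENNReal.ofReal_rpow_of_nonneg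
      (mul_nonneg (weight_nonneg hs0 _ _) hD0) hr.le]
    refine ENNReal.rpow_le_rpow ?_ hr.le
    have hyA : y x ∈ (A : Set (EuclideanSpace ℝ (Fin k))) := by simp [A]
    refine (Metric.infEDist_le_edist_of_mem hyA).trans ?_
    rw [edist_dist, ← hz]
    refine ENNReal.ofReal_le_ofReal ((I.dist_branch_le _ _ z x₀).trans ?_)
    exact mul_le_mul_of_nonneg_left (hD z x₀) (weight_nonneg hs0 _ _)
  have hp1 : ∀ j, I.stationary j ≤ 1 := fun j => by
    rw [← I.isStationary_stationary.2.1]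
    exact Finset.single_le_sum (fun j _ => I.isStationary_stationary.1 j) (Finset.mem_univ j)
  refine (lintegral_mono hpt).trans ?_
  rw [lintegral_finsetSum _ fun x _ => measurable_const.indicator (hmeas x)]
  have hw0 := fun x => weight_nonneg (I.edgeWeight_nonneg (r := r) I.s_pos) (i x) (σ x)
  rw [Finset.mul_sum, ENNReal.ofReal_sum_of_nonneg fun x _ =>
    mul_nonneg (Real.rpow_nonneg hD0 r) (hw0 x)]
  refine Finset.sum_le_sum fun x _ => ?_
  rw [lintegral_indicator_const (hmeas x), markovMeasure_cylinder, ← ENNReal.ofReal_mul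
    (Real.rpow_nonneg (mul_nonneg (weight_nonneg hs0 _ _) hD0) _)]
  refine ENNReal.ofReal_le_ofReal ?_
  have hw := hw0 x
  rw [I.weight_edgeWeight hs0] at hw ⊢
  rw [Real.mul_rpow (weight_nonneg hs0 _ _) hD0]
  have hDr := Real.rpow_nonneg hD0 r
  calc weight I.s (i x) (σ x) ^ r * D ^ r * (I.stationary (i x) * weight (fun i j => I.P i j) (i x) (σ x))
      = I.stationary (i x) *
        (D ^ r * (weight (fun i j => I.P i j) (i x) (σ x) * weight I.s (i x) (σ x) ^ r)) := by ring
    _ ≤ 1 * (D ^ r * (weight (fun i j => I.P i j) (i x) (σ x) * weight I.s (i x) (σ x) ^ r)) := by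
      gcongr
      exact hp1 _
    _ = _ := one_mul _

lemma exists_quantizationError_le_rpow {r t : ℝ} (hr : 0 < r) (ht : 0 < t) (ht1 : t < 1)
    (h : realRadius (I.pressureMatrix I.s r t) < 1) :
    ∃ C : ℝ, 0 < C ∧ ∀ᶠ n : ℕ in atTop,
      quantizationError I.limitMeasure r n ≤ ENNReal.ofReal (C * (n : ℝ) ^ (-((1 - t) / t))) := by
  have := I.nonempty_fin
  obtain ⟨v, hv1, hv⟩ := exists_mulVec_le_self (I.pressureMatrix_nonneg I.s_pos t) h
  obtain ⟨q, b, hq, hq1, hb, hb1, hub, hlb⟩ := I.exists_edgeWeight_bounds I.s_pos I.s_lt_one hr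
  have hub' : ∀ i j, I.edgeWeight I.s r i j ≤ b := fun i j =>
    (hub i j).trans (by nlinarith [I.P_le_one i j])
  obtain ⟨D, hD0, hD⟩ : ∃ D : ℝ, 0 < D ∧ ∀ x y : I.X, dist x y ≤ D :=
    ⟨Metric.diam I.X + 1, by positivity, fun x y =>
      (Metric.dist_le_diam_of_mem I.isCompact.isBounded x.2 y.2).trans (by linarith)⟩
  have hS : 0 < ∑ i, v i :=
    Finset.sum_pos (fun i _ => zero_lt_one.trans_le (hv1 i)) Finset.univ_nonempty
  set S := q⁻¹ * ∑ i, v i with hSdef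
  have hS0 : 0 < S := by positivity
  refine ⟨D ^ r * S * S ^ ((1 - t) / t), by positivity, ?_⟩
  filter_upwards [eventually_ge_atTop (⌈S⌉₊ + 1)] with n hn
  have hnS : S ≤ n := (Nat.le_ceil S).trans (by exact_mod_cast (Nat.le_succ _).trans hn)
  have hn0 : (0 : ℝ) < n := hS0.trans_le hnS
  have hx0 : 0 < n / S := by positivity
  -- The threshold solves S ε^(-t) = n, so that at most n words occur; n ≥ S makes it at most 1.
  set ε : ℝ := (n / S) ^ (-(1 / t)) with hε
  have hε0 : 0 < ε := by positivity
  have hε1 : ε ≤ 1 := Real.rpow_le_one_of_one_le_of_nonpos ((one_le_div hS0).2 hnS) (by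
    rw [neg_nonpos]; positivity)
  have e1 : ε ^ (-t) = n / S := by
    rw [hε, ← Real.rpow_mul hx0.le, neg_mul_neg, one_div_mul_cancel ht.ne', Real.rpow_one]
  have e2 : ε ^ (1 - t) = S ^ ((1 - t) / t) * (n : ℝ) ^ (-((1 - t) / t)) := by
    rw [hε, ← Real.rpow_mul hx0.le, show -(1 / t) * (1 - t) = -((1 - t) / t) by ring,
      div_rpow_neg_eq hn0 hS0, mul_comm]
  obtain ⟨m, hm⟩ := exists_pow_lt_of_lt_one hε0 hb1
  choose ι hι σ hcov hcard hsum using I.exists_covering_words I.s_pos ht ht1 hq hq1 hb hub' hlb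
    hv1 hv m ε hm.le (hε1.trans ((one_le_inv₀ hq).2 hq1.le))
  have key := I.quantizationError_le_of_cover (ι := Σ i, ι i) (fun x => x.1) (fun x => σ x.1 x.2)
    (fun τ => by
      obtain ⟨x, hx⟩ := hcov (τ.1 0) τ.1 τ.2 rfl
      exact ⟨⟨τ.1 0, x⟩, hx⟩) hr hD0.le hD
  have hle : Fintype.card (Σ i, ι i) ≤ n := by
    have : (Fintype.card (Σ i, ι i) : ℝ) ≤ n := by
      rw [Fintype.card_sigma]
      push_cast
      calc ∑ i, (Fintype.card (ι i) : ℝ) ≤ ∑ i, q⁻¹ * v i * ε ^ (-t) :=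
            Finset.sum_le_sum fun i _ => hcard i
        _ = S * ε ^ (-t) := by rw [hSdef, Finset.mul_sum, Finset.sum_mul]
        _ = n := by rw [e1, mul_div_cancel₀ _ hS0.ne']
    exact_mod_cast this
  refine (quantizationError_antitone _ r hle).trans (key.trans (ENNReal.ofReal_le_ofReal ?_))
  rw [Fintype.sum_sigma]
  calc D ^ r * ∑ i, ∑ x, weight (I.edgeWeight I.s r) i (σ i x)
      ≤ D ^ r * ∑ i, q⁻¹ * v i * ε ^ (1 - t) := by
        gcongr with i _
        exact hsum i
    _ = D ^ r * S * S ^ ((1 - t) / t) * (n : ℝ) ^ (-((1 - t) / t)) := by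
        rw [← Finset.sum_mul, ← Finset.mul_sum, ← hSdef, e2]
        ring

end BiLipschitzRIFS

/-! ### Lower bound for the quantization error -/

/-- Sets of mass at least `c ρ⁻ʳ` with disjoint `ρ`-neighbourhoods bound quantization errors from
below. -/
lemma le_lintegral_infEDist_of_separated {E ι : Type*} [MetricSpace E] [MeasurableSpace E]
    [BorelSpace E] [Fintype ι] (μ : Measure E) {B : ι → Set E} (hB : ∀ x, MeasurableSet (B x))
    {ρ : ι → ℝ} (hρ : ∀ x, 0 < ρ x)
    (hsep : ∀ x y, x ≠ y → ∀ u ∈ B x, ∀ v ∈ B y, ρ x + ρ y ≤ dist u v) {r : ℝ} (hr : 0 < r)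
    {c : ℝ≥0∞} (hc : ∀ x, c ≤ ENNReal.ofReal (ρ x) ^ r * μ (B x)) (A : Finset E) {m : ℕ}
    (hA : A.card + m ≤ Fintype.card ι) :
    m * c ≤ ∫⁻ x, Metric.infEDist x (A : Set E) ^ r ∂μ := by
  classical
  -- A set is good when no point of A lies within ρ of it. By separation each point of A spoils at
  -- most one set, so at most `A.card` sets are bad.
  let good : Finset ι := Finset.univ.filter fun x => ∀ a ∈ A, ∀ u ∈ B x, ρ x ≤ dist u a
  have hbad : goodᶜ.card ≤ A.card := by
    refine Finset.card_le_card_of_forall_subsingleton (fun x a => ∃ u ∈ B x, dist u a < ρ x)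
      (fun x hx => by simpa [good] using hx) fun a _ x ⟨_, u, hu, hxu⟩ y ⟨_, v, hv, hyv⟩ => ?_
    by_contra hne
    linarith [hsep x y hne u hu v hv, dist_triangle_right u v a]
  have hgood : m ≤ good.card := by
    have := Finset.card_add_card_compl good
    omega
  have hdisj : (good : Set ι).PairwiseDisjoint B := fun x _ y _ hxy =>
    Set.disjoint_left.2 fun u hu hv => by
      have := hsep x y hxy u hu u hv
      rw [dist_self] at this
      linarith [hρ x, hρ y]
  calc (m : ℝ≥0∞) * c ≤ good.card * c := by gcongr
    _ = ∑ x ∈ good, c := by rw [Finset.sum_const, nsmul_eq_mul]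
    _ ≤ ∑ x ∈ good, ∫⁻ u in B x, Metric.infEDist u (A : Set E) ^ r ∂μ := by
      refine Finset.sum_le_sum fun x hx => (hc x).trans ?_
      rw [← setLIntegral_const]
      refine setLIntegral_mono' (hB x) fun u hu => ENNReal.rpow_le_rpow ?_ hr.le
      refine Metric.le_infEDist.2 fun a ha => ?_
      rw [edist_dist]
      exact ENNReal.ofReal_le_ofReal ((Finset.mem_filter.1 hx).2 a ha u hu)
    _ = ∫⁻ u in ⋃ x ∈ good, B x, Metric.infEDist u (A : Set E) ^ r ∂μ :=
      (lintegral_biUnion_finset hdisj (fun x _ => hB x) _).symm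
    _ ≤ _ := setLIntegral_le_lintegral _ _

namespace BiLipschitzRIFS

variable {k N : ℕ} (I : BiLipschitzRIFS k N)

section OpenSets

variable {I} {U : Fin N → Set I.X}

lemma branch_image_subset (hsub : ∀ i j, I.f i j '' U j ⊆ U i) (i : Fin N) (l : List (Fin N)) :
    I.branch i l '' U (endpoint i l) ⊆ U i := by
  induction l generalizing i with
  | nil => simp [branch, endpoint]
  | cons j l ih =>
    rw [branch, image_comp]
    exact (image_mono (ih j)).trans (hsub i j)

/-- Common initial letters are stripped by injectivity; at the first difference the images are
disjoint by the open set condition. Equal lengths rule out that one word is a prefix of the other.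
-/
lemma disjoint_branch_image
    (hdis : ∀ i j m l, (i, j) ≠ (m, l) → Disjoint (I.f i j '' U j) (I.f m l '' U l))
    (hsub : ∀ i j, I.f i j '' U j ⊆ U i) (i : Fin N) (l l' : List (Fin N))
    (hlen : l.length = l'.length) (hne : l ≠ l') :
    Disjoint (I.branch i l '' U (endpoint i l)) (I.branch i l' '' U (endpoint i l')) := by
  induction l generalizing i l' with
  | nil => exact absurd (List.length_eq_zero_iff.1 hlen.symm).symm hne
  | cons j l ih =>
    cases l' with
    | nil => simp at hlen
    | cons j' l' =>
      rw [branch, branch, image_comp, image_comp]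
      by_cases hj : j = j'
      · subst hj
        exact (disjoint_image_iff (I.injective_f i j)).2
          (ih j l' (by simpa using hlen) fun h => hne (by rw [h]))
      · exact (hdis i j i j' fun h => hj (Prod.ext_iff.1 h).2).mono
          (image_mono (branch_image_subset hsub j l)) (image_mono (branch_image_subset hsub j' l'))

end OpenSets

lemma exists_word_of_pow_pos (m : ℕ) (i j : Fin N) (h : 0 < (I.P ^ m) i j) :
    ∃ l, endpoint i l = j ∧ 0 < weight (fun i j => I.P i j) i l := by
  induction m generalizing i with
  | zero =>
    refine ⟨[], ?_, zero_lt_one⟩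
    by_contra hne
    have hij : i ≠ j := hne
    simp [hij] at h
  | succ m ih =>
    rw [pow_succ', Matrix.mul_apply] at h
    obtain ⟨x, -, hx⟩ := Finset.exists_lt_of_sum_lt (f := fun _ => (0 : ℝ)) (by simpa using h)
    have hP : 0 < I.P i x := (I.P_nonneg i x).lt_of_ne fun h0 => by simp [← h0] at hx
    obtain ⟨l, hl, hw⟩ := ih x (pos_of_mul_pos_right hx hP.le)
    exact ⟨x :: l, hl, mul_pos hP hw⟩

lemma exists_word (i j : Fin N) : ∃ l, endpoint i l = j ∧ 0 < weight (fun i j => I.P i j) i l := by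
  obtain ⟨m, -, hm⟩ :=
    (Matrix.isIrreducible_iff_exists_pow_pos I.irreducible.nonneg).1 I.irreducible i j
  exact I.exists_word_of_pow_pos m i j hm

lemma exists_word_of_mem_limitSet (m : ℕ) (i : Fin N) (x : I.X) (hx : x ∈ I.limitSet i) :
    ∃ l, l.length = m ∧ 0 < weight (fun i j => I.P i j) i l ∧ x ∈ range (I.branch i l) := by
  induction m generalizing i x with
  | zero => exact ⟨[], rfl, zero_lt_one, x, rfl⟩
  | succ m ih =>
    rw [(I.isInvariantFamily_limitSet i).2.2] at hx
    simp only [mem_iUnion] at hx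
    obtain ⟨j, hj, y, hy, rfl⟩ := hx
    obtain ⟨l, hl, hw, z, rfl⟩ := ih j y hy
    exact ⟨j :: l, by simp [hl], mul_pos hj hw, z, rfl⟩

lemma lipschitzWith_branch {K : ℝ≥0} (hK : ∀ i j, LipschitzWith K (I.f i j)) (i : Fin N)
    (l : List (Fin N)) : LipschitzWith (K ^ l.length) (I.branch i l) := by
  induction l generalizing i with
  | nil => simpa [branch] using LipschitzWith.id
  | cons j l ih =>
    rw [List.length_cons, pow_succ']
    exact (hK i j).comp (ih j)

/-- This is where the open sets must meet the limit sets. A limit point in U lies in arbitrarily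
small pieces, so a long word maps all of X into U. Prolonging it to end at j only shrinks its range.
-/
lemma exists_word_range_subset {U : Set I.X} (hU : IsOpen U) (i j : Fin N)
    (hE : (I.limitSet i ∩ U).Nonempty) :
    ∃ l, l ≠ [] ∧ endpoint i l = j ∧ 0 < weight (fun i j => I.P i j) i l ∧ range (I.branch i l) ⊆ U := by
  obtain ⟨x, hxE, hxU⟩ := hE
  obtain ⟨ε, hε, hball⟩ := Metric.isOpen_iff.1 hU x hxU
  obtain ⟨K, hK, hf⟩ := I.exists_ratio
  have hlim : Tendsto (fun n : ℕ => (K : ℝ) ^ n * Metric.diam I.X) atTop (𝓝 0) := by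
    simpa using (tendsto_pow_atTop_nhds_zero_of_lt_one K.2 (by exact_mod_cast hK)).mul_const
      (Metric.diam I.X)
  obtain ⟨m, hm, hm1⟩ := ((hlim.eventually_lt_const hε).and (eventually_ge_atTop 1)).exists
  obtain ⟨l, hl, hw, y, rfl⟩ := I.exists_word_of_mem_limitSet m i x hxE
  obtain ⟨l', hl', hw'⟩ := I.exists_word (endpoint i l) j
  refine ⟨l ++ l', ?_, ?_, ?_, ?_⟩
  · intro h
    rw [(List.append_eq_nil_iff.1 h).1] at hl
    simp at hl
    omega
  · rw [endpoint_append, hl']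
  · rw [weight_append]
    exact mul_pos hw hw'
  · rw [I.branch_append]
    refine (range_comp_subset_range _ _).trans ?_
    rintro _ ⟨z, rfl⟩
    refine hball (lt_of_le_of_lt ((I.lipschitzWith_branch hf i l).dist_le_mul z y) ?_)
    rw [hl]
    push_cast
    refine lt_of_le_of_lt ?_ hm
    gcongr
    exact Metric.dist_le_diam_of_mem I.isCompact.isBounded z.2 y.2

/-- The row sums of the powers of `[(p_ij a_ij^r)^t]` are sums over words. -/
lemma exists_words_row_sum_eq {a : Fin N → Fin N → ℝ} {r t : ℝ} (ha : ∀ i j, 0 < a i j)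
    (ht : 0 < t) (m : ℕ) (i : Fin N) :
    ∃ (ι : Type) (_ : Fintype ι) (σ : ι → List (Fin N)), Function.Injective σ ∧
      (∀ x, (σ x).length = m ∧ 0 < weight (fun i j => I.P i j) i (σ x)) ∧
      ∑ j, (I.pressureMatrix a r t ^ m) i j = ∑ x, weight (I.edgeWeight a r) i (σ x) ^ t := by
  classical
  induction m generalizing i with
  | zero =>
    exact ⟨Unit, inferInstance, fun _ => [], fun _ _ _ => rfl, fun _ => ⟨rfl, zero_lt_one⟩,
      by simp [weight, Matrix.one_apply]⟩
  | succ m ih =>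
    choose ι hι σ hinj hσ hsum using ih
    refine ⟨Σ j : {j // 0 < I.P i j}, ι j.1, inferInstance, fun x => x.1.1 :: σ x.1.1 x.2,
      ?_, fun x => ⟨by simp [(hσ _ x.2).1], mul_pos x.1.2 (hσ _ x.2).2⟩, ?_⟩
    · rintro ⟨⟨j, hj⟩, x⟩ ⟨⟨j', hj'⟩, x'⟩ h
      obtain ⟨h1, h2⟩ := List.cons.inj h
      change j = j' at h1
      subst h1
      obtain rfl := hinj j h2
      rfl
    · rw [Fintype.sum_sigma]
      have e1 : ∑ j, (I.pressureMatrix a r t ^ (m + 1)) i j =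
          ∑ j, I.pressureMatrix a r t i j * ∑ l, (I.pressureMatrix a r t ^ m) j l := by
        simp_rw [pow_succ', Matrix.mul_apply, Finset.mul_sum]
        exact Finset.sum_comm
      rw [e1, ← Fintype.sum_subtype_add_sum_subtype (fun j => 0 < I.P i j)]
      -- Forbidden edges contribute 0^t = 0 because t > 0.
      have e2 : ∑ j : {j // ¬ 0 < I.P i j}, I.pressureMatrix a r t i j *
          ∑ l, (I.pressureMatrix a r t ^ m) j l = 0 := by
        refine Finset.sum_eq_zero fun j _ => ?_
        rw [pressureMatrix, Matrix.of_apply, I.edgeWeight_eq_zero j.2, Real.zero_rpow ht.ne',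
          zero_mul]
      rw [e2, add_zero]
      refine Finset.sum_congr rfl fun j _ => ?_
      rw [hsum, Finset.mul_sum]
      refine Finset.sum_congr rfl fun x _ => ?_
      exact (Real.mul_rpow (I.edgeWeight_nonneg ha i j)
        (weight_nonneg (I.edgeWeight_nonneg ha) _ _)).symm

/-- A finite subsystem of loops with the strong separation condition. -/
lemma exists_separated_loops (hI : I.StrongOpenSetCondition) {r t : ℝ} (ht : 0 < t)
    (h : 1 < realRadius (I.pressureMatrix I.c r t)) :
    ∃ (i : Fin N) (κ : Type) (_ : Fintype κ) (γ : κ → List (Fin N)) (δ : ℝ), 0 < δ ∧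
      (∀ x, γ x ≠ [] ∧ endpoint i (γ x) = i ∧ 0 < weight (fun i j => I.P i j) i (γ x)) ∧
      1 ≤ ∑ x, weight (I.edgeWeight I.c r) i (γ x) ^ t ∧
      ∀ x y, x ≠ y → ∀ u v, δ ≤ dist (I.branch i (γ x) u) (I.branch i (γ y) v) := by
  classical
  have := I.nonempty_fin
  have : CompactSpace I.X := isCompact_iff_compactSpace.1 I.isCompact
  have : Nonempty I.X := I.nonempty.to_subtype
  obtain ⟨U, hU, hdis, hsub, hE⟩ := hI
  -- The word T j i maps X into U j and ends at i; appended to a word ending at j, it closes a loop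
  -- at i.
  choose T hT0 hTend hTw hTU using fun i j => I.exists_word_range_subset (hU i).1 i j (hE i)
  have hwpos : ∀ i l, 0 < weight (fun i j => I.P i j) i l → 0 < weight (I.edgeWeight I.c r) i l := by
    intro i l hl
    rw [I.weight_edgeWeight fun i j => (I.c_pos i j).le]
    exact mul_pos hl (Real.rpow_pos_of_pos (weight_pos I.c_pos i l) r)
  obtain ⟨η, hη, hηle⟩ : ∃ η, 0 < η ∧ ∀ j j', η ≤ weight (I.edgeWeight I.c r) j (T j j') ^ t := by
    obtain ⟨p, hp⟩ := Finite.exists_min fun p : Fin N × Fin N =>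
      weight (I.edgeWeight I.c r) p.1 (T p.1 p.2) ^ t
    exact ⟨_, Real.rpow_pos_of_pos (hwpos _ _ (hTw p.1 p.2)) t, fun j j' => hp (j, j')⟩
  -- Closing a word costs at most a factor η, so a row sum above η⁻¹ leaves a sum of at least 1.
  obtain ⟨m, i, hmi⟩ := exists_lt_row_sum_pow (I.pressureMatrix_nonneg I.c_pos t) h η⁻¹
  obtain ⟨κ, hκ, σ, hinj, hσ, hsum⟩ := I.exists_words_row_sum_eq (r := r) I.c_pos ht m i
  let γ : κ → List (Fin N) := fun x => σ x ++ T (endpoint i (σ x)) i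
  -- The closed words map X into the images of the open sets under the words σ, which have equal
  -- length and are distinct.
  have hne : ∀ x y, x ≠ y → ∀ u v, I.branch i (γ x) u ≠ I.branch i (γ y) v := by
    intro x y hxy u v
    have hmem : ∀ x u, I.branch i (γ x) u ∈ I.branch i (σ x) '' U (endpoint i (σ x)) := by
      intro x u
      simp only [γ, I.branch_append, Function.comp]
      exact mem_image_of_mem _ (hTU _ _ ⟨u, rfl⟩)
    exact (disjoint_branch_image hdis hsub i (σ x) (σ y) ((hσ x).1.trans (hσ y).1.symm)
      (hinj.ne hxy)).ne_of_mem (hmem x u) (hmem y v)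
  have hδ : ∀ z : κ × κ, ∃ δ : ℝ, 0 < δ ∧ (z.1 ≠ z.2 → ∀ u v,
      δ ≤ dist (I.branch i (γ z.1) u) (I.branch i (γ z.2) v)) := by
    rintro ⟨x, y⟩
    by_cases hxy : x = y
    · exact ⟨1, one_pos, fun h => absurd hxy h⟩
    have hcont : Continuous fun w : I.X × I.X =>
        dist (I.branch i (γ x) w.1) (I.branch i (γ y) w.2) :=
      ((I.continuous_branch i (γ x)).comp continuous_fst).dist
        ((I.continuous_branch i (γ y)).comp continuous_snd)
    obtain ⟨w, -, hw⟩ := isCompact_univ.exists_isMinOn univ_nonempty hcont.continuousOn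
    exact ⟨dist (I.branch i (γ x) w.1) (I.branch i (γ y) w.2), dist_pos.2 (hne x y hxy w.1 w.2),
      fun _ u v => isMinOn_iff.1 hw (u, v) (mem_univ _)⟩
  choose δ hδ0 hδ using hδ
  have hsum1 : 1 ≤ ∑ x, weight (I.edgeWeight I.c r) i (γ x) ^ t := by
    rw [hsum] at hmi
    have hw0 := weight_nonneg (I.edgeWeight_nonneg (r := r) I.c_pos)
    calc 1 = η⁻¹ * η := (inv_mul_cancel₀ hη.ne').symm
      _ ≤ (∑ x, weight (I.edgeWeight I.c r) i (σ x) ^ t) * η := by gcongr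
      _ = ∑ x, weight (I.edgeWeight I.c r) i (σ x) ^ t * η := by rw [Finset.sum_mul]
      _ ≤ _ := by
        refine Finset.sum_le_sum fun x _ => ?_
        rw [weight_append, Real.mul_rpow (hw0 _ _) (hw0 _ _)]
        exact mul_le_mul_of_nonneg_left (hηle _ _) (Real.rpow_nonneg (hw0 _ _) t)
  have hκ0 : Nonempty κ := by
    by_contra hemp
    rw [not_nonempty_iff] at hemp
    simp at hsum1
    linarith
  obtain ⟨z, hz⟩ := Finite.exists_min δ
  refine ⟨i, κ, hκ, γ, δ z, hδ0 z, fun x => ⟨?_, ?_, ?_⟩, hsum1, fun x y hxy u v =>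
    (hz (x, y)).trans (hδ (x, y) hxy u v)⟩
  · exact fun h0 => hT0 _ _ (List.append_eq_nil_iff.1 h0).2
  · rw [endpoint_append, hTend]
  · rw [weight_append]
    exact mul_pos (hσ x).2 (hTw _ _)

/-- In a subsystem of loops with strong separation, there are many words of a given weight, whose
pieces have disjoint neighbourhoods of comparable size. -/
lemma exists_separated_words {r t δ q b : ℝ} {i : Fin N} {κ : Type} [Fintype κ]
    {γ : κ → List (Fin N)} (ht : 0 < t) (hq : 0 < q) (hb : 0 < b) (hδ : 0 < δ)
    (hend : ∀ x, endpoint i (γ x) = i)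
    (hlb : ∀ x, q ≤ weight (I.edgeWeight I.c r) i (γ x))
    (hub : ∀ x, weight (I.edgeWeight I.c r) i (γ x) ≤ b)
    (hsum : 1 ≤ ∑ x, weight (I.edgeWeight I.c r) i (γ x) ^ t)
    (hsep : ∀ x y, x ≠ y → ∀ u v, δ ≤ dist (I.branch i (γ x) u) (I.branch i (γ y) v))
    (m : ℕ) (ε : ℝ) (hε : b ^ m ≤ ε) (hε1 : ε ≤ q⁻¹) :
    ∃ (ι : Type) (_ : Fintype ι) (σ : ι → List (Fin N)), ε ^ (-t) ≤ Fintype.card ι ∧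
      (∀ x, q * ε ≤ weight (I.edgeWeight I.c r) i (σ x)) ∧
      ∀ x y, x ≠ y → ∀ u v, δ / 2 * weight I.c i (σ x) + δ / 2 * weight I.c i (σ y) ≤
        dist (I.branch i (σ x) u) (I.branch i (σ y) v) := by
  have base : ∀ ε : ℝ, 1 ≤ ε → ε ≤ q⁻¹ →
      ∃ (ι : Type) (_ : Fintype ι) (σ : ι → List (Fin N)), ε ^ (-t) ≤ Fintype.card ι ∧
      (∀ x, q * ε ≤ weight (I.edgeWeight I.c r) i (σ x)) ∧
      ∀ x y, x ≠ y → ∀ u v, δ / 2 * weight I.c i (σ x) + δ / 2 * weight I.c i (σ y) ≤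
        dist (I.branch i (σ x) u) (I.branch i (σ y) v) := by
    intro ε hε hε1
    refine ⟨Unit, inferInstance, fun _ => [], ?_, fun _ => ?_, fun x y hxy => (hxy rfl).elim⟩
    · simpa using Real.rpow_le_one_of_one_le_of_nonpos hε (neg_nonpos.2 ht.le)
    · calc q * ε ≤ q * q⁻¹ := by gcongr
        _ = 1 := mul_inv_cancel₀ hq.ne'
  induction m generalizing ε with
  | zero => exact base ε (by simpa using hε) hε1
  | succ m ih =>
    rcases le_or_gt 1 ε with hle | hlt
    · exact base ε hle hε1
    have hε0 : 0 < ε := lt_of_lt_of_le (by positivity) hε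
    let Q : κ → ℝ := fun x => weight (I.edgeWeight I.c r) i (γ x)
    have hQ : ∀ x, 0 < Q x := fun x => hq.trans_le (hlb x)
    -- Each first loop x is followed by words for the threshold ε / Q x, which stays at most q⁻¹
    -- while ε < 1.
    choose ι hι σ hcard hw hdist using fun x : κ => ih (ε / Q x) (by
      rw [le_div_iff₀ (hQ x)]
      refine le_trans ?_ hε
      rw [pow_succ]
      gcongr
      exact hub x) (by
      rw [div_le_iff₀ (hQ x)]
      have e : q⁻¹ * q ≤ q⁻¹ * Q x := mul_le_mul_of_nonneg_left (hlb x) (inv_nonneg.2 hq.le)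
      rw [inv_mul_cancel₀ hq.ne'] at e
      linarith)
    have hc1 := weight_le_one (fun i j => (I.c_pos i j).le) I.c_le_one
    refine ⟨Σ x, ι x, inferInstance, fun z => γ z.1 ++ σ z.1 z.2, ?_, fun z => ?_, ?_⟩
    · rw [Fintype.card_sigma]
      push_cast
      calc ε ^ (-t) ≤ ε ^ (-t) * ∑ x, Q x ^ t := le_mul_of_one_le_right (by positivity) hsum
        _ = ∑ x, (ε / Q x) ^ (-t) := by
          rw [Finset.mul_sum]
          exact Finset.sum_congr rfl fun x _ => (div_rpow_neg_eq hε0 (hQ x) t).symm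
        _ ≤ _ := Finset.sum_le_sum fun x _ => hcard x
    · rw [weight_append, hend]
      calc q * ε = Q z.1 * (q * (ε / Q z.1)) := by
            have := (hQ z.1).ne'
            field_simp
        _ ≤ _ := mul_le_mul_of_nonneg_left (hw z.1 z.2) (hQ z.1).le
    · rintro ⟨x, a⟩ ⟨y, b⟩ hne u v
      by_cases hxy : x = y
      · subst hxy
        have hab : a ≠ b := fun h => hne (by rw [h])
        simp only [weight_append, I.branch_append, hend, Function.comp]
        -- With the same first loop, the separation of the tails shrinks by at most the factor c of
        -- that loop, exactly as the radii do.
        refine le_trans ?_ (I.weight_c_mul_dist_le i (γ x) _ _)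
        calc _ = weight I.c i (γ x) *
              (δ / 2 * weight I.c i (σ x a) + δ / 2 * weight I.c i (σ x b)) := by ring
          _ ≤ _ := mul_le_mul_of_nonneg_left (hdist x a b hab u v) (weight_pos I.c_pos _ _).le
      -- With different first loops the gap is at least δ, while both radii are at most δ/2.
      · have e1 := hc1 i (γ x ++ σ x a)
        have e2 := hc1 i (γ y ++ σ y b)
        simp only [I.branch_append i (γ _), Function.comp]
        refine le_trans ?_ (hsep x y hxy _ _)
        nlinarith

lemma exists_rpow_le_quantizationError (hI : I.StrongOpenSetCondition) {r t : ℝ} (hr : 0 < r)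
    (ht : 0 < t) (h : 1 < realRadius (I.pressureMatrix I.c r t)) :
    ∃ C : ℝ, 0 < C ∧ ∀ᶠ n : ℕ in atTop,
      ENNReal.ofReal (C * (n : ℝ) ^ (-((1 - t) / t))) ≤ quantizationError I.limitMeasure r n := by
  obtain ⟨i, κ, hκ, γ, δ, hδ, hγ, hsum, hsep⟩ := I.exists_separated_loops hI ht h
  obtain ⟨-, b, -, -, hb, hb1, hub, -⟩ := I.exists_edgeWeight_bounds I.c_pos
    (fun i j => (I.c_le_s i j).trans_lt (I.s_lt_one i j)) hr
  have hub' : ∀ i j, I.edgeWeight I.c r i j ≤ b := fun i j =>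
    (hub i j).trans (by nlinarith [I.P_le_one i j])
  have hw0 := I.edgeWeight_nonneg (r := r) I.c_pos
  have hc0 := fun i j => (I.c_pos i j).le
  -- A loop is nonempty, so its weight contains at least one factor bounded by b.
  have hubγ : ∀ x, weight (I.edgeWeight I.c r) i (γ x) ≤ b := fun x => by
    cases hx : γ x with
    | nil => exact absurd hx (hγ x).1
    | cons j l =>
      have h1 := weight_le_one hw0 (fun i j => (hub' i j).trans hb1.le) j l
      exact (mul_le_mul (hub' i j) h1 (weight_nonneg hw0 j l) hb.le).trans_eq (mul_one b)
  have hκ0 : Nonempty κ := by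
    by_contra hemp
    rw [not_nonempty_iff] at hemp
    simp at hsum
    linarith
  obtain ⟨x₀, hx₀⟩ := Finite.exists_min fun x => weight (I.edgeWeight I.c r) i (γ x)
  set q := weight (I.edgeWeight I.c r) i (γ x₀)
  have hq : 0 < q := by
    rw [show q = _ from I.weight_edgeWeight hc0 r i (γ x₀)]
    exact mul_pos (hγ x₀).2.2 (Real.rpow_pos_of_pos (weight_pos I.c_pos _ _) r)
  have hp := I.stationary_pos i
  -- Each piece has (radius)^r times mass at least c₀ ε: the mass supplies the stationary factor and
  -- p_w, the radius supplies (δ/2)^r and c_w^r, and p_w c_w^r ≥ qε.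
  set c₀ := I.stationary i * (δ / 2) ^ r * q with hc₀
  have hc₀0 : 0 < c₀ := by positivity
  refine ⟨c₀ * 2 ^ (-(1 / t)), by positivity, ?_⟩
  filter_upwards [eventually_ge_atTop 1] with n hn
  have hn1 : (1 : ℝ) ≤ n := by exact_mod_cast hn
  have hn0 : (0 : ℝ) < n := by linarith
  -- This makes ε^(-t) = 2n: twice as many pieces as centres, so at least n pieces stay away from A.
  set ε : ℝ := (2 * n) ^ (-(1 / t)) with hε
  have hε0 : 0 < ε := by positivity
  have hε1 : ε ≤ 1 := Real.rpow_le_one_of_one_le_of_nonpos (by linarith) (by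
    rw [neg_nonpos]; positivity)
  have e1 : ε ^ (-t) = 2 * n := by
    rw [hε, ← Real.rpow_mul (by positivity), neg_mul_neg, one_div_mul_cancel ht.ne', Real.rpow_one]
  obtain ⟨m, hm⟩ := exists_pow_lt_of_lt_one hε0 hb1
  obtain ⟨ι, hι, σ, hcard, hw, hdist⟩ := I.exists_separated_words ht hq hb hδ
    (fun x => (hγ x).2.1) hx₀ hubγ hsum hsep m ε hm.le
    (hε1.trans ((one_le_inv₀ hq).2 ((hubγ x₀).trans hb1.le)))
  have hcard' : n + n ≤ Fintype.card ι := by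
    rw [e1] at hcard
    have : ((n + n : ℕ) : ℝ) ≤ Fintype.card ι := by push_cast; linarith
    exact_mod_cast this
  refine le_iInf₂ fun A hA => ?_
  have key := le_lintegral_infEDist_of_separated I.limitMeasure
    (B := fun x => I.piece i (σ x)) (fun x => (I.isCompact_piece i (σ x)).measurableSet)
    (ρ := fun x => δ / 2 * weight I.c i (σ x))
    (fun x => mul_pos (half_pos hδ) (weight_pos I.c_pos _ _))
    (by
      rintro x y hxy _ ⟨u, rfl⟩ _ ⟨v, rfl⟩
      exact hdist x y hxy u v) hr (c := ENNReal.ofReal (c₀ * ε)) (fun x => by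
      have hρ : 0 ≤ δ / 2 * weight I.c i (σ x) :=
        mul_nonneg (half_pos hδ).le (weight_pos I.c_pos _ _).le
      refine le_trans ?_ (mul_le_mul_right (I.le_limitMeasure_piece i (σ x)) _)
      rw [ENNReal.ofReal_rpow_of_nonneg hρ hr.le, ← ENNReal.ofReal_mul (Real.rpow_nonneg hρ r)]
      refine ENNReal.ofReal_le_ofReal ?_
      have h1 := hw x
      rw [I.weight_edgeWeight hc0] at h1
      rw [Real.mul_rpow (half_pos hδ).le (weight_pos I.c_pos _ _).le]
      calc c₀ * ε = I.stationary i * (δ / 2) ^ r * (q * ε) := by rw [hc₀]; ring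
        _ ≤ I.stationary i * (δ / 2) ^ r * (weight (fun i j => I.P i j) i (σ x) * weight I.c i (σ x) ^ r) := by
          gcongr
        _ = _ := by ring) A (m := n) (by omega)
  refine le_trans (Eq.le ?_) key
  rw [← ENNReal.ofReal_natCast, ← ENNReal.ofReal_mul hn0.le]
  congr 1
  rw [hε, Real.mul_rpow (by norm_num) hn0.le,
    show -((1 - t) / t) = 1 + -(1 / t) by field_simp; ring, Real.rpow_add hn0, Real.rpow_one]
  ring

end BiLipschitzRIFS

/-! ### From polynomial error bounds to quantization dimensions -/

lemma tendsto_log_natCast_atTop : Tendsto (fun n : ℕ => Real.log n) atTop atTop :=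
  Real.tendsto_log_atTop.comp tendsto_natCast_atTop_atTop

/-- A polynomial upper bound for `V` bounds the exponents of `V ^ (1 / r)` from above. -/
lemma eventually_log_div_le_of_le_rpow {V : ℕ → ℝ} {C r u v : ℝ} (hr : 0 < r) (hu : 0 < u)
    (huv : u < v) (hC : 0 < C) (hV0 : ∀ᶠ n in atTop, 0 < V n)
    (hV : ∀ᶠ n : ℕ in atTop, V n ≤ C * (n : ℝ) ^ (-(r / u))) :
    ∀ᶠ n : ℕ in atTop, 0 < -Real.log (V n ^ (1 / r)) ∧
      Real.log n / -Real.log (V n ^ (1 / r)) ≤ v := by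
  have hv : 0 < v := hu.trans huv
  -- For large n, this gap times log n absorbs the contribution of the constant C.
  have hd : 0 < 1 / u - 1 / v := sub_pos.2 (one_div_lt_one_div_of_lt hu huv)
  filter_upwards [hV0, hV, tendsto_log_natCast_atTop.eventually_ge_atTop 1,
    tendsto_log_natCast_atTop.eventually_ge_atTop (1 / r * Real.log C / (1 / u - 1 / v)),
    eventually_ge_atTop 1] with n h0 h1 h2 h3 hn
  have hn0 : (0 : ℝ) < n := by positivity
  have h4 := Real.log_le_log h0 h1
  rw [Real.log_mul hC.ne' (by positivity), Real.log_rpow hn0] at h4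
  rw [div_le_iff₀ hd] at h3
  rw [Real.log_rpow h0]
  have h5 : Real.log n / v ≤ -(1 / r * Real.log (V n)) := by
    have h6 := mul_le_mul_of_nonneg_left h4 (one_div_pos.2 hr).le
    have h7 : 1 / r * (Real.log C + -(r / u) * Real.log n) =
        1 / r * Real.log C - Real.log n * (1 / u) := by
      field_simp
      ring
    rw [h7] at h6
    rw [div_eq_mul_one_div (Real.log n) v]
    linarith
  have hX : 0 < -(1 / r * Real.log (V n)) := lt_of_lt_of_le (by positivity) h5
  refine ⟨hX, (div_le_iff₀ hX).2 ?_⟩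
  rwa [div_le_iff₀' hv] at h5

/-- A polynomial lower bound for `V` bounds the exponents of `V ^ (1 / r)` from below. -/
lemma eventually_le_log_div_of_rpow_le {V : ℕ → ℝ} {C r u v : ℝ} (hr : 0 < r) (hv : 0 < v)
    (hvu : v < u) (hC : 0 < C) (hV0 : ∀ᶠ n in atTop, 0 < -Real.log (V n ^ (1 / r)))
    (hV : ∀ᶠ n : ℕ in atTop, C * (n : ℝ) ^ (-(r / u)) ≤ V n) :
    ∀ᶠ n : ℕ in atTop, v ≤ Real.log n / -Real.log (V n ^ (1 / r)) := by
  have hu : 0 < u := hv.trans hvu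
  have hd : 0 < 1 / v - 1 / u := sub_pos.2 (one_div_lt_one_div_of_lt hv hvu)
  filter_upwards [hV0, hV,
    tendsto_log_natCast_atTop.eventually_ge_atTop (-(1 / r * Real.log C) / (1 / v - 1 / u)),
    eventually_ge_atTop 1] with n hX h1 h3 hn
  have hn0 : (0 : ℝ) < n := by positivity
  have hpos : 0 < C * (n : ℝ) ^ (-(r / u)) := by positivity
  have h4 := Real.log_le_log hpos h1
  rw [Real.log_mul hC.ne' (by positivity), Real.log_rpow hn0] at h4
  rw [div_le_iff₀ hd] at h3
  rw [le_div_iff₀ hX, ← le_div_iff₀' hv, Real.log_rpow (hpos.trans_le h1)]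
  have h6 := mul_le_mul_of_nonneg_left h4 (one_div_pos.2 hr).le
  have h7 : 1 / r * (Real.log C + -(r / u) * Real.log n) =
      1 / r * Real.log C - Real.log n * (1 / u) := by
    field_simp
    ring
  rw [h7] at h6
  rw [div_eq_mul_one_div (Real.log n) v]
  linarith

namespace BiLipschitzRIFS

variable {k N : ℕ} (I : BiLipschitzRIFS k N)

lemma div_add_lt_div_add {r u v : ℝ} (hr : 0 < r) (hu : 0 < u) (huv : u < v) :
    u / (r + u) < v / (r + v) := by
  rw [div_lt_div_iff₀ (by linarith) (by linarith)]
  nlinarith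

lemma one_sub_div_div_eq {r u : ℝ} (hr : 0 < r) (hu : 0 < u) :
    (1 - u / (r + u)) / (u / (r + u)) = r / u := by
  have : r + u ≠ 0 := by positivity
  field_simp
  ring

lemma eventually_toReal_quantizationError_le {r u v : ℝ} (hr : 0 < r) (hu : 0 < u)
    (h : realRadius (I.pressureMatrix I.s r (u / (r + u))) = 1) (huv : u < v) :
    ∃ C : ℝ, 0 < C ∧ ∀ᶠ n : ℕ in atTop, quantizationError I.limitMeasure r n ≠ ⊤ ∧
      (quantizationError I.limitMeasure r n).toReal ≤ C * (n : ℝ) ^ (-(r / v)) := by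
  have hv := hu.trans huv
  have ht0 : 0 < v / (r + v) := by positivity
  have hlt : realRadius (I.pressureMatrix I.s r (v / (r + v))) < 1 := by
    -- Strict monotonicity is available only at a positive radius, so radius 0 is treated apart.
    rcases (realRadius_nonneg (I.pressureMatrix I.s r (v / (r + v)))).eq_or_lt with h0 | h0
    · rw [← h0]; exact zero_lt_one
    · rw [← h]
      exact I.realRadius_pressureMatrix_lt I.s_pos I.s_lt_one hr (by positivity)
        (div_add_lt_div_add hr hu huv) h0
  obtain ⟨C, hC, hev⟩ := I.exists_quantizationError_le_rpow hr ht0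
    ((div_lt_one (by linarith)).2 (by linarith)) hlt
  rw [one_sub_div_div_eq hr hv] at hev
  exact ⟨C, hC, hev.mono fun n hn => ⟨ne_top_of_le_ne_top ENNReal.ofReal_ne_top hn,
    ENNReal.toReal_le_of_le_ofReal (by positivity) hn⟩⟩

lemma eventually_le_quantizationError (hI : I.StrongOpenSetCondition) {r u v : ℝ} (hr : 0 < r)
    (hv : 0 < v) (h : realRadius (I.pressureMatrix I.c r (u / (r + u))) = 1) (hvu : v < u) :
    ∃ C : ℝ, 0 < C ∧ ∀ᶠ n : ℕ in atTop,
      ENNReal.ofReal (C * (n : ℝ) ^ (-(r / v))) ≤ quantizationError I.limitMeasure r n := by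
  have ht0 : 0 < v / (r + v) := by positivity
  have hlt : 1 < realRadius (I.pressureMatrix I.c r (v / (r + v))) := by
    rw [← h]
    exact I.realRadius_pressureMatrix_lt I.c_pos
      (fun i j => (I.c_le_s i j).trans_lt (I.s_lt_one i j)) hr ht0
      (div_add_lt_div_add hr hv hvu) (by rw [h]; exact zero_lt_one)
  have := I.exists_rpow_le_quantizationError hI hr ht0 hlt
  rwa [one_sub_div_div_eq hr hv] at this

end BiLipschitzRIFS

theorem theorem3p1 {k N : ℕ} (I : BiLipschitzRIFS k N) (hI : I.StrongOpenSetCondition)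
    (hP : ∀ σ : Equiv.Perm (Fin N), I.P ≠ σ.permMatrix ℝ) (r : ℝ) (hr : 0 < r) :
    (∃! l : ℝ, 0 < l ∧ I.lowerRadius r (l / (r + l)) = 1) ∧
    (∃! u : ℝ, 0 < u ∧ I.upperRadius r (u / (r + u)) = 1) ∧
    ∀ l u : ℝ, 0 < l → I.lowerRadius r (l / (r + l)) = 1 →
      0 < u → I.upperRadius r (u / (r + u)) = 1 →
        (l : EReal) ≤ lowerQuantizationDim I.limitMeasure r ∧
        lowerQuantizationDim I.limitMeasure r ≤ upperQuantizationDim I.limitMeasure r ∧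
        upperQuantizationDim I.limitMeasure r ≤ (u : EReal) := by
  simp only [I.lowerRadius_eq_one_iff, I.upperRadius_eq_one_iff]
  refine ⟨I.existsUnique_realRadius_pressureMatrix_eq_one hP I.c_pos
    (fun i j => (I.c_le_s i j).trans_lt (I.s_lt_one i j)) hr,
    I.existsUnique_realRadius_pressureMatrix_eq_one hP I.s_pos I.s_lt_one hr, ?_⟩
  intro l u hl hl1 hu hu1
  -- The lower bound keeps the error from vanishing, so its logarithm is meaningful in the upper
  -- estimate too.
  have hpos : ∀ᶠ n : ℕ in atTop, 0 < (quantizationError I.limitMeasure r n).toReal := by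
    obtain ⟨C, hC, h1⟩ := I.eventually_le_quantizationError hI hr (half_pos hl) hl1
      (half_lt_self hl)
    obtain ⟨_, _, h2⟩ := I.eventually_toReal_quantizationError_le hr hu hu1 (lt_add_one u)
    filter_upwards [h1, h2, eventually_ge_atTop 1] with n h1 h2 hn
    have hn0 : (0 : ℝ) < n := by positivity
    exact ENNReal.toReal_pos ((ENNReal.ofReal_pos.2 (by positivity)).trans_le h1).ne' h2.1
  have hupper : ∀ v w, u < v → v < w → ∀ᶠ n : ℕ in atTop,
      0 < -Real.log ((quantizationError I.limitMeasure r n).toReal ^ (1 / r)) ∧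
        quantizationRatio I.limitMeasure r n ≤ w := by
    intro v w huv hvw
    obtain ⟨C, hC, h⟩ := I.eventually_toReal_quantizationError_le hr hu hu1 huv
    exact eventually_log_div_le_of_le_rpow hr (hu.trans huv) hvw hC hpos
      (h.mono fun n hn => hn.2)
  have hlower : ∀ v w, 0 < v → v < w → w < l → ∀ᶠ n : ℕ in atTop,
      v ≤ quantizationRatio I.limitMeasure r n := by
    intro v w hv hvw hwl
    obtain ⟨C, hC, h1⟩ := I.eventually_le_quantizationError hI hr (hv.trans hvw) hl1 hwl
    obtain ⟨_, _, h2⟩ := I.eventually_toReal_quantizationError_le hr hu hu1 (lt_add_one u)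
    refine eventually_le_log_div_of_rpow_le hr hv hvw hC
      ((hupper (u + 1) (u + 2) (by linarith) (by linarith)).mono fun n hn => hn.1) ?_
    filter_upwards [h1, h2] with n h1 h2
    exact (ENNReal.ofReal_le_iff_le_toReal h2.1).1 h1
  refine ⟨?_, liminf_le_limsup, ?_⟩
  · refine le_of_forall_lt fun x hx => ?_
    obtain ⟨y, hxy, hyl⟩ := EReal.lt_iff_exists_real_btwn.1 hx
    -- The real y may be negative; replacing it by the maximum with l/2 provides the positive
    -- exponent that the lower estimate requires.
    have hyl' : max y (l / 2) < l := max_lt (EReal.coe_lt_coe_iff.1 hyl) (half_lt_self hl)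
    obtain ⟨w, hw1, hw2⟩ := exists_between hyl'
    refine (hxy.trans_le (EReal.coe_le_coe_iff.2 (le_max_left y (l / 2)))).trans_le
      (le_liminf_of_le (by isBoundedDefault) ?_)
    exact (hlower _ w ((half_pos hl).trans_le (le_max_right _ _)) hw1 hw2).mono
      fun n hn => EReal.coe_le_coe_iff.2 hn
  · refine le_of_forall_gt fun x hx => ?_
    obtain ⟨y, huy, hyx⟩ := EReal.lt_iff_exists_real_btwn.1 hx
    obtain ⟨v, hv1, hv2⟩ := exists_between (EReal.coe_lt_coe_iff.1 huy)
    refine lt_of_le_of_lt (limsup_le_of_le (by isBoundedDefault) ?_) hyx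
    exact (hupper v y hv1 hv2).mono fun n hn => EReal.coe_le_coe_iff.2 hn.2
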